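/- Let $\pi: Y\to X$ be a smooth fibre bundle, $n=\dim X$, with fibred coordinates $(x^\lambda,y^i)$. Write $\omega=dx^1\wedge\cdots\wedge dx^n$ and $\omega_\lambda=\partial_\lambda\rfloor\omega$. Let $J^1Y$ be the first order jet manifold, with coordinates $(x^\lambda,y^i,y^i_\lambda)$. Let $\Pi=\bigwedge^nT^*X\otimes_Y V^*Y\otimes_Y TX$ be the Legendre bundle, with coordinates $(x^\lambda,y^i,p^\lambda_i)$ and projection $\pi_Y:\Pi\to Y$. Let $Z_Y=T^*Y\wedge(\bigwedge^{n-1}T^*X)$ be the bundle of the $n$-forms $p\,\omega+p^\lambda_i\,dy^i\wedge\omega_\lambda$, which projects onto $\Pi$ by $(p,p^\lambda_i)\mapsto(p^\lambda_i)$. Write $\partial_i=\partial/\partial y^i$, $\partial^\lambda_i=\partial/\partial y^i_\lambda$, $\partial^i_\lambda=\partial/\partial p^\lambda_i$. A smooth Lagrangian $L=\mathcal L\,\omega:J^1Y\to\bigwedge^nT^*X$ defines the Legendre map $\widehat L:J^1Y\to\Pi$ over $Y$, $p^\lambda_i\circ\widehat L=\partial^\lambda_i\mathcal L$, and the Lagrangian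 constraint space $N_L=\widehat L(J^1Y)$. A Hamiltonian $\mathcal H$ is a smooth section $p=-\mathcal H$ of $Z_Y\to\Pi$; it defines the Hamiltonian map $\widehat H:\Pi\to J^1Y$ over $Y$, $y^i_\lambda\circ\widehat H=\partial^i_\lambda\mathcal H$. The Lagrangian $L$ is almost-regular if $N_L$ is a closed imbedded subbundle of $\Pi\to Y$ and the surjection $\widehat L:J^1Y\to N_L$ is a submersion with connected fibres. The Hamiltonian $\mathcal H$ is associated to $L$ if, at all points of $N_L$, $$p^\mu_i=\partial^\mu_i\mathcal L(x^\mu,y^j,\partial^j_\lambda\mathcal H),\qquad p^\mu_i\,\partial^i_\mu\mathcal H-\mathcal H=\mathcal L(x^\mu,y^j,\partial^j_\lambda\mathcal H).$$ Consider the following equations for smooth sections over an open set $U\subseteq X$, where a total derivative along a section is the partial derivative $\partial/\partial x^\lambda$ of the composition with that section (or its jet). * Hamilton equations, for a section $r$ of $\Pi\to X$: $\partial_\lambda y^i=\partial^i_\lambda\mathcal H$ and $\partial_\lambda p^\lambda_i=-\partial_i\mathcal H$ along $r$. * Euler–Lagrange equations, for a section $s$ of $Y\to X$: $\partial_i\mathcal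 L-d_\lambda\partial^\lambda_i\mathcal L=0$ along $J^1s$. * Cartan equations, for a section $\overline s=(y^i(x),y^i_\lambda(x))$ of $J^1Y\to X$: with $\pi^\lambda_i=\partial^\lambda_i\mathcal L$ and $\widehat y^i_\lambda=\partial y^i(x)/\partial x^\lambda$, $$\partial^\lambda_i\pi^\mu_j\,(\widehat y^j_\mu-y^j_\mu)=0,\qquad \partial_i\mathcal L-\widehat d_\lambda\pi^\lambda_i+(\widehat y^j_\lambda-y^j_\lambda)\,\partial_i\pi^\lambda_j=0\quad\text{along }\overline s.$$ **Theorem.** Let $L$ be an almost-regular Lagrangian, $\mathcal H$ a Hamiltonian associated to $L$, and $U\subseteq X$ open (for instance $U=X$). 1. If a section $r$ of $\Pi\to X$ over $U$ is a solution of the Hamilton equations for $\mathcal H$ and takes its values in $N_L$, then $s=\pi_Y\circ r$ satisfies the Euler–Lagrange equations for $L$, and $\overline s=\widehat H\circ r$ satisfies the Cartan equations for $L$. 2. Conversely, let a section $\overline s$ of $J^1Y\to X$ over $U$ be a solution of the Cartan equations for $L$, and let $\pi^1_0:J^1Y\to Y$ be the projection. If $\widehat H\circ\widehat L\circ\overline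 s=J^1(\pi^1_0\circ\overline s)$ on $U$, then $r=\widehat L\circ\overline s$ is a solution of the Hamilton equations for $\mathcal H$. -/

import Mathlib

open Set
open scoped Manifold ContDiff Topology

noncomputable section

namespace Polysymplectic

/-! ## Coordinate spaces -/

/-- `ℝⁿ`, on which `X` is modelled (and, with `m` for `n`, the typical fibre of `Y → X`). -/
abbrev Eu (n : ℕ) := EuclideanSpace ℝ (Fin n)

/-- The model space `ℝⁿ × ℝᵐ` of the total space `Y`; a point is `(x^λ, y^i)`. -/
abbrev TotMod (n m : ℕ) := Eu n × Eu m

/-- Arrays indexed by `λ : Fin n`, `i : Fin m`: the values `y^i_λ` of jet coordinates and the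
values `p^λ_i` of momentum coordinates. -/
abbrev Arr (n m : ℕ) := Fin n → Fin m → ℝ

/-- Exterior `n`-forms on `ℝⁿ`, the vector space underlying `⋀ⁿ T*_x X`, as a normed space. -/
def TopForm (n : ℕ) : Type := (Eu n) [⋀^Fin n]→L[ℝ] ℝ

instance (n : ℕ) : NormedAddCommGroup (TopForm n) :=
  inferInstanceAs (NormedAddCommGroup ((Eu n) [⋀^Fin n]→L[ℝ] ℝ))

instance (n : ℕ) : NormedSpace ℝ (TopForm n) :=
  inferInstanceAs (NormedSpace ℝ ((Eu n) [⋀^Fin n]→L[ℝ] ℝ))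

/-- An exterior form, as an element of `TopForm`. -/
def TopForm.of {n : ℕ} (al : (Eu n) [⋀^Fin n]→L[ℝ] ℝ) : TopForm n := al

/-- An element of `TopForm`, as an exterior form. -/
def TopForm.val {n : ℕ} (al : TopForm n) : (Eu n) [⋀^Fin n]→L[ℝ] ℝ := al

/-- Evaluation of forms at `n` vectors: `ev w α = α(w₁, …, wₙ)`. -/
def TopForm.ev {n : ℕ} (w : Fin n → Eu n) : TopForm n →L[ℝ] ℝ :=
  (ContinuousAlternatingMap.apply ℝ (Eu n) ℝ w : ((Eu n) [⋀^Fin n]→L[ℝ] ℝ) →L[ℝ] ℝ)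

theorem TopForm.ev_apply {n : ℕ} (w : Fin n → Eu n) (al : TopForm n) :
    TopForm.ev w al = al.val w := rfl

theorem TopForm.ext {n : ℕ} {al be : TopForm n} (h : ∀ w, TopForm.ev w al = TopForm.ev w be) :
    al = be :=
  ContinuousAlternatingMap.ext h

/-- The standard basis vector. -/
def stdVec {n : ℕ} (l : Fin n) : Eu n := EuclideanSpace.single l (1 : ℝ)

/-- The array with a single entry `1`, at `(λ, i)`. -/
def stdArr {n m : ℕ} (l : Fin n) (i : Fin m) : Arr n m := Pi.single l (Pi.single i 1)

/-- The linear map `ℝⁿ → ℝᵐ`, `u ↦ (∑_λ v^i_λ u^λ)_i`. -/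
def arrMap {n m : ℕ} (v : Arr n m) : Eu n →L[ℝ] Eu m :=
  ∑ l, (EuclideanSpace.proj l : Eu n →L[ℝ] ℝ).smulRight (WithLp.toLp 2 (v l) : Eu m)

/-- The standard volume form `dx¹ ∧ … ∧ dxⁿ` on `ℝⁿ`. -/
def stdVol (n : ℕ) : TopForm n := TopForm.of
  { ((EuclideanSpace.basisFun (Fin n) ℝ).toBasis.det) with
    cont := by
      have : Continuous fun w : Fin n → Eu n =>
          ((EuclideanSpace.basisFun (Fin n) ℝ).toBasis.toMatrix w).det := by
        refine Continuous.matrix_det ?_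
        refine continuous_matrix fun i j => ?_
        simp only [Module.Basis.toMatrix_apply, OrthonormalBasis.coe_toBasis_repr_apply,
          EuclideanSpace.basisFun_repr]
        fun_prop
      exact this }

/-! ## Fibre bundles and fibred coordinates -/

/-- A smooth fibre bundle `Y → X` with typical fibre `F`. -/
structure FibBundle (n m : ℕ) (X Y F : Type*)
    [TopologicalSpace X] [ChartedSpace (Eu n) X]
    [TopologicalSpace Y] [ChartedSpace (TotMod n m) Y]
    [TopologicalSpace F] [ChartedSpace (Eu m) F] where
  /-- the projection `Y → X` -/
  proj : Y → X
  smooth : ContMDiff 𝓘(ℝ, TotMod n m) 𝓘(ℝ, Eu n) ∞ proj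
  locTriv : ∀ x : X, ∃ e : Bundle.Trivialization F proj, x ∈ e.baseSet ∧
    ContMDiffOn 𝓘(ℝ, TotMod n m) (𝓘(ℝ, Eu n).prod 𝓘(ℝ, Eu m)) ∞ e e.source ∧
    ContMDiffOn (𝓘(ℝ, Eu n).prod 𝓘(ℝ, Eu m)) 𝓘(ℝ, TotMod n m) ∞ e.toOpenPartialHomeomorph.symm
      e.target

variable {n m : ℕ} {X Y F : Type*}
  [TopologicalSpace X] [ChartedSpace (Eu n) X]
  [TopologicalSpace Y] [ChartedSpace (TotMod n m) Y]
  [TopologicalSpace F] [ChartedSpace (Eu m) F]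

/-- The differential of the projection at `y`, as a map `T_y Y → T_{π(y)} X`.  (In Mathlib the
vector spaces underlying `T_y Y` and `T_x X` are the model spaces.) -/
def FibBundle.dproj (B : FibBundle n m X Y F) (y : Y) : TotMod n m →L[ℝ] Eu n :=
  mfderiv 𝓘(ℝ, TotMod n m) 𝓘(ℝ, Eu n) B.proj y

/-- The vertical tangent space `V_y Y`, as a subspace of `T_y Y`. -/
def FibBundle.vert (B : FibBundle n m X Y F) (y : Y) : Submodule ℝ (TotMod n m) :=
  LinearMap.ker (B.dproj y : TotMod n m →ₗ[ℝ] Eu n)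

/-- The vertical tangent space `V_y Y`, as a normed space. -/
def FibBundle.Vert (B : FibBundle n m X Y F) (y : Y) : Type := ↥(B.vert y)

instance (B : FibBundle n m X Y F) (y : Y) : NormedAddCommGroup (B.Vert y) :=
  inferInstanceAs (NormedAddCommGroup ↥(B.vert y))

instance (B : FibBundle n m X Y F) (y : Y) : NormedSpace ℝ (B.Vert y) :=
  inferInstanceAs (NormedSpace ℝ ↥(B.vert y))

instance (B : FibBundle n m X Y F) (y : Y) : FiniteDimensional ℝ (B.Vert y) :=
  inferInstanceAs (FiniteDimensional ℝ ↥(B.vert y))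

/-- The inclusion `V_y Y → T_y Y`. -/
def FibBundle.incl (B : FibBundle n m X Y F) (y : Y) : B.Vert y →L[ℝ] TotMod n m :=
  ((B.vert y).subtypeL : ↥(B.vert y) →L[ℝ] TotMod n m)

/-- A vertical vector, as an element of `V_y Y`. -/
def FibBundle.mkVert (B : FibBundle n m X Y F) (y : Y) (u : TotMod n m) (h : u ∈ B.vert y) :
    B.Vert y := ⟨u, h⟩

theorem FibBundle.dproj_incl (B : FibBundle n m X Y F) (y : Y) (u : B.Vert y) :
    B.dproj y (B.incl y u) = 0 := u.2

theorem FibBundle.incl_injective (B : FibBundle n m X Y F) (y : Y) :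
    Function.Injective (B.incl y) := Subtype.val_injective

/-- The vector space `T*_x X ⊗ V_y Y = Hom(T_x X, V_y Y)`, `x = π(y)`, as a normed space. -/
def FibBundle.VertHom (B : FibBundle n m X Y F) (y : Y) : Type := Eu n →L[ℝ] B.Vert y

instance (B : FibBundle n m X Y F) (y : Y) : NormedAddCommGroup (B.VertHom y) :=
  inferInstanceAs (NormedAddCommGroup (Eu n →L[ℝ] B.Vert y))

instance (B : FibBundle n m X Y F) (y : Y) : NormedSpace ℝ (B.VertHom y) :=
  inferInstanceAs (NormedSpace ℝ (Eu n →L[ℝ] B.Vert y))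

instance (B : FibBundle n m X Y F) (y : Y) : FiniteDimensional ℝ (B.VertHom y) :=
  inferInstanceAs (FiniteDimensional ℝ (Eu n →L[ℝ] B.Vert y))

/-- A linear map `T_x X → V_y Y`, as an element of `VertHom`. -/
def FibBundle.mkHom (B : FibBundle n m X Y F) (y : Y) (xi : Eu n →L[ℝ] B.Vert y) :
    B.VertHom y := xi

/-- The inclusion `Hom(T_x X, V_y Y) → Hom(T_x X, T_y Y)`. -/
def FibBundle.inclHom (B : FibBundle n m X Y F) (y : Y) :
    B.VertHom y →L[ℝ] Eu n →L[ℝ] TotMod n m :=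
  (ContinuousLinearMap.compL ℝ (Eu n) (B.Vert y) (TotMod n m) (B.incl y) :
    (Eu n →L[ℝ] B.Vert y) →L[ℝ] Eu n →L[ℝ] TotMod n m)

theorem FibBundle.inclHom_mkHom (B : FibBundle n m X Y F) (y : Y) (xi : Eu n →L[ℝ] B.Vert y)
    (w : Eu n) : B.inclHom y (B.mkHom y xi) w = B.incl y (xi w) := rfl

theorem FibBundle.dproj_inclHom (B : FibBundle n m X Y F) (y : Y) (xi : B.VertHom y) (w : Eu n) :
    B.dproj y (B.inclHom y xi w) = 0 := B.dproj_incl y _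

theorem FibBundle.inclHom_injective (B : FibBundle n m X Y F) (y : Y) :
    Function.Injective (B.inclHom y) := by
  intro a b h
  refine ContinuousLinearMap.ext (f := (a : Eu n →L[ℝ] B.Vert y)) (g := b) fun w => ?_
  exact B.incl_injective y (DFunLike.congr_fun h w)

/-- The fibre `⋀ⁿT*_x X ⊗ V*_y Y ⊗ T_x X = Hom(T*_x X ⊗ V_y Y, ⋀ⁿT*_x X)`, `x = π(y)`, of the
Legendre bundle. -/
abbrev FibBundle.MomFibre (B : FibBundle n m X Y F) (y : Y) := B.VertHom y →L[ℝ] TopForm n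

/-- Fibred coordinates `(x^λ, y^i)` on `Y → X`: a smooth chart of `Y` and a smooth chart of `X`
such that the `x^λ` on `Y` are pulled back from `X`. -/
structure FibChart (B : FibBundle n m X Y F) where
  base : OpenPartialHomeomorph X (Eu n)
  total : OpenPartialHomeomorph Y (TotMod n m)
  base_mem : base ∈ IsManifold.maximalAtlas 𝓘(ℝ, Eu n) ∞ X
  total_mem : total ∈ IsManifold.maximalAtlas 𝓘(ℝ, TotMod n m) ∞ Y
  proj_mem : ∀ y ∈ total.source, B.proj y ∈ base.source
  compat : ∀ y ∈ total.source, (total y).1 = base (B.proj y)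

namespace FibChart

variable {B : FibBundle n m X Y F} (c : FibChart B)

/-- Differential of the chart of `X`. -/
def dBase (x : X) : Eu n →L[ℝ] Eu n := mfderiv 𝓘(ℝ, Eu n) 𝓘(ℝ, Eu n) c.base x

/-- Differential of the inverse of the chart of `X`; the image of the `λ`-th standard vector
is `∂_λ ∈ T_x X`. -/
def dBaseSymm (t : Eu n) : Eu n →L[ℝ] Eu n := mfderiv 𝓘(ℝ, Eu n) 𝓘(ℝ, Eu n) c.base.symm t

/-- Differential of the chart of `Y`. -/
def dTotal (y : Y) : TotMod n m →L[ℝ] TotMod n m :=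
  mfderiv 𝓘(ℝ, TotMod n m) 𝓘(ℝ, TotMod n m) c.total y

/-- Differential of the inverse of the chart of `Y`; the images of the standard vectors are the
coordinate vectors `∂_λ, ∂_i ∈ T_y Y`. -/
def dTotalSymm (a : TotMod n m) : TotMod n m →L[ℝ] TotMod n m :=
  mfderiv 𝓘(ℝ, TotMod n m) 𝓘(ℝ, TotMod n m) c.total.symm a

/-- The coordinate frame `(∂_1, …, ∂_n)` of `T_x X`. -/
def frameX (x : X) (l : Fin n) : Eu n := c.dBaseSymm (c.base x) (stdVec l)

/-- The part `(∂_1, …, ∂_n)` of the coordinate frame of `T_y Y`. -/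
def frameY (y : Y) (l : Fin n) : TotMod n m := c.dTotalSymm (c.total y) (stdVec l, 0)

theorem dBaseSymm_dBase {x : X} (hx : x ∈ c.base.source) (w : Eu n) :
    c.dBaseSymm (c.base x) (c.dBase x w) = w := by
  have h : c.base.MDifferentiable 𝓘(ℝ, Eu n) 𝓘(ℝ, Eu n) :=
    ⟨(contMDiffOn_of_mem_maximalAtlas c.base_mem).mdifferentiableOn (by simp),
      (contMDiffOn_symm_of_mem_maximalAtlas c.base_mem).mdifferentiableOn (by simp)⟩
  exact DFunLike.congr_fun (h.symm_comp_deriv hx) w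

theorem dBase_dBaseSymm {x : X} (hx : x ∈ c.base.source) (w : Eu n) :
    c.dBase x (c.dBaseSymm (c.base x) w) = w := by
  have h : c.base.MDifferentiable 𝓘(ℝ, Eu n) 𝓘(ℝ, Eu n) :=
    ⟨(contMDiffOn_of_mem_maximalAtlas c.base_mem).mdifferentiableOn (by simp),
      (contMDiffOn_symm_of_mem_maximalAtlas c.base_mem).mdifferentiableOn (by simp)⟩
  have := DFunLike.congr_fun (h.comp_symm_deriv (c.base.map_source hx)) w
  rw [c.base.left_inv hx] at this
  exact this

theorem mdiff_total : c.total.MDifferentiable 𝓘(ℝ, TotMod n m) 𝓘(ℝ, TotMod n m) :=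
  ⟨(contMDiffOn_of_mem_maximalAtlas c.total_mem).mdifferentiableOn (by simp),
      (contMDiffOn_symm_of_mem_maximalAtlas c.total_mem).mdifferentiableOn (by simp)⟩

theorem dTotalSymm_dTotal {y : Y} (hy : y ∈ c.total.source) (w : TotMod n m) :
    c.dTotalSymm (c.total y) (c.dTotal y w) = w :=
  DFunLike.congr_fun (c.mdiff_total.symm_comp_deriv hy) w

theorem dTotal_dTotalSymm {y : Y} (hy : y ∈ c.total.source) (w : TotMod n m) :
    c.dTotal y (c.dTotalSymm (c.total y) w) = w := by
  have := DFunLike.congr_fun (c.mdiff_total.comp_symm_deriv (c.total.map_source hy)) w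
  rw [c.total.left_inv hy] at this
  exact this

theorem dTotal_fst {y : Y} (hy : y ∈ c.total.source) (w : TotMod n m) :
    (c.dTotal y w).1 = c.dBase (B.proj y) (B.dproj y w) := by
  have hb : MDifferentiableAt 𝓘(ℝ, Eu n) 𝓘(ℝ, Eu n) c.base (B.proj y) :=
    ((contMDiffOn_of_mem_maximalAtlas c.base_mem).mdifferentiableOn (by simp)).mdifferentiableAt
      (c.base.open_source.mem_nhds (c.proj_mem y hy))
  have hp : MDifferentiableAt 𝓘(ℝ, TotMod n m) 𝓘(ℝ, Eu n) B.proj y :=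
    B.smooth.mdifferentiableAt (by simp)
  have ht : MDifferentiableAt 𝓘(ℝ, TotMod n m) 𝓘(ℝ, TotMod n m) c.total y :=
    c.mdiff_total.mdifferentiableAt hy
  have h1 := hb.hasMFDerivAt.comp y hp.hasMFDerivAt
  have hf : HasMFDerivAt 𝓘(ℝ, TotMod n m) 𝓘(ℝ, Eu n) (Prod.fst : TotMod n m → Eu n) (c.total y)
      (ContinuousLinearMap.fst ℝ (Eu n) (Eu m)) :=
    (ContinuousLinearMap.fst ℝ (Eu n) (Eu m)).hasFDerivAt.hasMFDerivAt
  have h2 := hf.comp y ht.hasMFDerivAt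
  have he : (c.base ∘ B.proj) =ᶠ[𝓝 y] (Prod.fst ∘ c.total) := by
    filter_upwards [c.total.open_source.mem_nhds hy] with z hz
    exact (c.compat z hz).symm
  have h3 := hasMFDerivAt_unique h2 (h1.congr_of_eventuallyEq he.symm)
  exact DFunLike.congr_fun h3 w

theorem dproj_dTotalSymm {y : Y} (hy : y ∈ c.total.source) (w : TotMod n m) :
    B.dproj y (c.dTotalSymm (c.total y) w) = c.dBaseSymm (c.base (B.proj y)) w.1 := by
  have h := c.dTotal_fst hy (c.dTotalSymm (c.total y) w)
  rw [c.dTotal_dTotalSymm hy] at h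
  rw [h, c.dBaseSymm_dBase (c.proj_mem y hy)]

end FibChart

/-- The projection is a submersion. -/
theorem FibBundle.exists_right_inv (B : FibBundle n m X Y F) (y : Y) :
    ∃ G : Eu n →L[ℝ] TotMod n m, (B.dproj y).comp G = ContinuousLinearMap.id ℝ (Eu n) := by
  obtain ⟨e, hx, -, he⟩ := B.locTriv (B.proj y)
  have hy : y ∈ e.source := e.mem_source.2 hx
  set f0 : F := (e y).2 with hf0
  have hpt : ((B.proj y, f0) : X × F) = e y := by
    rw [hf0, ← e.coe_fst hy]
  have hmem : ((B.proj y, f0) : X × F) ∈ e.target := e.mem_target.2 hx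
  have hs : MDifferentiableAt 𝓘(ℝ, Eu n) 𝓘(ℝ, TotMod n m)
      (fun x => e.toOpenPartialHomeomorph.symm (x, f0)) (B.proj y) := by
    have h1 : MDifferentiableAt (𝓘(ℝ, Eu n).prod 𝓘(ℝ, Eu m)) 𝓘(ℝ, TotMod n m)
        e.toOpenPartialHomeomorph.symm (B.proj y, f0) :=
      (he.contMDiffAt (e.open_target.mem_nhds hmem)).mdifferentiableAt (by simp)
    have h2 : MDifferentiableAt 𝓘(ℝ, Eu n) (𝓘(ℝ, Eu n).prod 𝓘(ℝ, Eu m))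
        (fun x : X => (x, f0)) (B.proj y) :=
      mdifferentiableAt_id.prodMk mdifferentiableAt_const
    exact h1.comp (B.proj y) h2
  have hsy : e.toOpenPartialHomeomorph.symm (B.proj y, f0) = y := by
    rw [hpt]; exact e.toOpenPartialHomeomorph.left_inv hy
  have hp : MDifferentiableAt 𝓘(ℝ, TotMod n m) 𝓘(ℝ, Eu n) B.proj
      (e.toOpenPartialHomeomorph.symm (B.proj y, f0)) :=
    B.smooth.mdifferentiableAt (by simp)
  have h1 := hp.hasMFDerivAt.comp (B.proj y) hs.hasMFDerivAt
  have heq : (B.proj ∘ fun x => e.toOpenPartialHomeomorph.symm (x, f0)) =ᶠ[𝓝 (B.proj y)] id := by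
    filter_upwards [e.open_baseSet.mem_nhds hx] with x hx'
    exact e.proj_symm_apply' hx'
  have h2 := hasMFDerivAt_unique (hasMFDerivAt_id (I := 𝓘(ℝ, Eu n)) (B.proj y))
    (h1.congr_of_eventuallyEq heq.symm)
  rw [hsy] at h2
  exact ⟨mfderiv 𝓘(ℝ, Eu n) 𝓘(ℝ, TotMod n m)
    (fun x => e.toOpenPartialHomeomorph.symm (x, f0)) (B.proj y), h2.symm⟩

/-! ## The jet bundle `J¹Y` -/

/-- A point of the first order jet manifold `J¹Y`: a point `y ∈ Y` together with a linear right
inverse `T_{π(y)} X → T_y Y` of the differential of the projection (the differential at `π(y)`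
of any local section representing the jet). -/
structure Jet (B : FibBundle n m X Y F) where
  point : Y
  lin : Eu n →L[ℝ] TotMod n m
  dproj_lin : (B.dproj point).comp lin = ContinuousLinearMap.id ℝ (Eu n)

/-- `J¹Y → Y` is an affine bundle modelled on `T*X ⊗ VY`: translation of a jet at `y` by an
element of `T*_{π(y)} X ⊗ V_y Y = Hom(T_{π(y)} X, V_y Y)`. -/
def Jet.shift {B : FibBundle n m X Y F} (z : Jet B) (xi : B.VertHom z.point) : Jet B where
  point := z.point
  lin := z.lin + B.inclHom z.point xi
  dproj_lin := by
    ext1 w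
    have h1 := DFunLike.congr_fun z.dproj_lin w
    have h2 := B.dproj_inclHom z.point xi w
    simp only [ContinuousLinearMap.comp_apply] at h1
    simp [h1, h2]

/-- Some jet at a given point. -/
def FibBundle.someJet (B : FibBundle n m X Y F) (y : Y) : Jet B :=
  ⟨y, (B.exists_right_inv y).choose, (B.exists_right_inv y).choose_spec⟩

/-- The pull-back `Γ*α ∈ ⋀ⁿ T*_x X` of an `n`-form `α ∈ ⋀ⁿ T*_y Y` by a jet `Γ : T_x X → T_y Y`
(the horizontal projection `h₀`). -/
def Jet.pull {B : FibBundle n m X Y F} (z : Jet B) (al : (TotMod n m) [⋀^Fin n]→L[ℝ] ℝ) :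
    TopForm n :=
  TopForm.of (al.compContinuousLinearMap z.lin)

open Classical in
/-- The first order jet prolongation `J¹s` of a section `s`: at `x` it is the point `s x` with the
differential of `s` at `x`.  (The other branch occurs only where `s` is not a differentiable
section.) -/
def FibBundle.prolong (B : FibBundle n m X Y F) (s : X → Y) (x : X) : Jet B :=
  if h : (B.dproj (s x)).comp
      (mfderiv 𝓘(ℝ, Eu n) 𝓘(ℝ, TotMod n m) s x : Eu n →L[ℝ] TotMod n m) =
      ContinuousLinearMap.id ℝ (Eu n) then
    ⟨s x, mfderiv 𝓘(ℝ, Eu n) 𝓘(ℝ, TotMod n m) s x, h⟩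
  else B.someJet (s x)

theorem arrMap_apply (v : Arr n m) (u : Eu n) (i : Fin m) :
    (arrMap v u) i = ∑ l, u l * v l i := by
  simp [arrMap]

theorem sum_stdVec (u : Eu n) : ∑ l, u l • stdVec l = u := by
  have := (EuclideanSpace.basisFun (Fin n) ℝ).sum_repr u
  simpa [stdVec] using this

theorem arrMap_stdVec (v : Arr n m) (l : Fin n) (i : Fin m) :
    (arrMap v (stdVec l)) i = v l i := by
  simp [arrMap_apply, stdVec, PiLp.single_apply]

theorem FibChart.dproj_symm_lin {B : FibBundle n m X Y F} (c : FibChart B)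
    (w : TotMod n m × Arr n m) (h : w.1 ∈ c.total.target) :
    (B.dproj (c.total.symm w.1)).comp ((c.dTotalSymm w.1).comp
      (((ContinuousLinearMap.id ℝ (Eu n)).prod (arrMap w.2)).comp
        (c.dBase (B.proj (c.total.symm w.1))))) = ContinuousLinearMap.id ℝ (Eu n) := by
  have hy := c.total.map_target h
  ext1 u
  have := c.dproj_dTotalSymm hy (c.dBase (B.proj (c.total.symm w.1)) u,
    arrMap w.2 (c.dBase (B.proj (c.total.symm w.1)) u))
  rw [c.total.right_inv h] at this
  have h2 := c.dBaseSymm_dBase (c.proj_mem _ hy) u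
  simp only [ContinuousLinearMap.comp_apply, ContinuousLinearMap.prod_apply,
    ContinuousLinearMap.id_apply]
  rw [this, h2]

open Classical in
/-- The coordinates `(x^λ, y^i, y^i_λ)` on `J¹Y`: for a jet `Γ` at `y`, one has
`Γ(∂_λ) = ∂_λ + y^i_λ ∂_i`. -/
def FibChart.jetChart {B : FibBundle n m X Y F} (c : FibChart B) :
    PartialEquiv (Jet B) (TotMod n m × Arr n m) where
  toFun z := (c.total z.point,
    fun l i => (c.dTotal z.point (z.lin (c.frameX (B.proj z.point) l))).2 i)
  invFun w :=
    if h : w.1 ∈ c.total.target then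
      { point := c.total.symm w.1
        lin := (c.dTotalSymm w.1).comp
          (((ContinuousLinearMap.id ℝ (Eu n)).prod (arrMap w.2)).comp
            (c.dBase (B.proj (c.total.symm w.1))))
        dproj_lin := c.dproj_symm_lin w h }
    else B.someJet (c.total.symm w.1)
  source := {z | z.point ∈ c.total.source}
  target := c.total.target ×ˢ univ
  map_source' z hz := ⟨c.total.map_source hz, mem_univ _⟩
  map_target' w hw := by
    have h : w.1 ∈ c.total.target := hw.1
    simp only [h, dif_pos]
    exact c.total.map_target h
  left_inv' z hz := by
    have hz' : z.point ∈ c.total.source := hz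
    have h := c.total.map_source hz'
    obtain ⟨y, G, hG⟩ := z
    simp only at hz' h ⊢
    rw [dif_pos h]
    have hl := c.total.left_inv hz'
    congr 1
    rw [hl]
    ext1 u
    simp only [ContinuousLinearMap.comp_apply, ContinuousLinearMap.prod_apply,
      ContinuousLinearMap.id_apply]
    rw [← c.dTotalSymm_dTotal hz' (G u)]
    congr 1
    have hGu : B.dproj y (G u) = u := DFunLike.congr_fun hG u
    refine Prod.ext ?_ ?_
    · simp only
      rw [c.dTotal_fst hz', hGu]
    · ext i
      simp only
      rw [arrMap_apply]
      have hu : u = ∑ l, (c.dBase (B.proj y) u) l • c.frameX (B.proj y) l := by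
        conv_lhs => rw [← c.dBaseSymm_dBase (c.proj_mem y hz') u,
          ← sum_stdVec (c.dBase (B.proj y) u)]
        simp [FibChart.frameX]
      conv_rhs => rw [hu]
      simp [Prod.snd_sum]
  right_inv' w hw := by
    have h : w.1 ∈ c.total.target := hw.1
    obtain ⟨a, v⟩ := w
    simp only at h ⊢
    rw [dif_pos h]
    have hy := c.total.map_target h
    refine Prod.ext ?_ ?_
    · exact c.total.right_inv h
    · funext l i
      simp only [ContinuousLinearMap.comp_apply, ContinuousLinearMap.prod_apply,
            ContinuousLinearMap.id_apply, FibChart.frameX]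
      rw [c.dBase_dBaseSymm (c.proj_mem _ hy)]
      have := c.dTotal_dTotalSymm hy (stdVec l, arrMap v (stdVec l))
      rw [c.total.right_inv h] at this
      rw [this]
      exact arrMap_stdVec v l i

/-! ## The Legendre bundle `Π` -/

/-- A point of the Legendre bundle `Π = ⋀ⁿT*X ⊗ V*Y ⊗ TX`: a point `y ∈ Y` together with an
element of the fibre `⋀ⁿT*_x X ⊗ V*_y Y ⊗ T_x X = Hom(T*_x X ⊗ V_y Y, ⋀ⁿT*_x X)`, `x = π(y)`,
where `T*_x X ⊗ V_y Y = Hom(T_x X, V_y Y)`. -/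
structure Momentum (B : FibBundle n m X Y F) where
  point : Y
  form : B.MomFibre point

theorem topForm_eq (al : TopForm n) : al = TopForm.ev stdVec al • stdVol n := by
  refine TopForm.ext fun w => ?_
  have h := AlternatingMap.eq_smul_basis_det (EuclideanSpace.basisFun (Fin n) ℝ).toBasis
    al.val.toAlternatingMap
  have h2 := congrArg (fun f => f w) h
  have h3 : ⇑((EuclideanSpace.basisFun (Fin n) ℝ).toBasis) = (stdVec : Fin n → Eu n) := by
    funext l
    simp [stdVec]
  rw [h3] at h2
  exact h2

namespace FibChart

variable {B : FibBundle n m X Y F} (c : FibChart B)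

/-- The form `ω = dx¹ ∧ … ∧ dxⁿ` at a point `x` of the chart of `X`. -/
def volX (x : X) : TopForm n := TopForm.of ((stdVol n).val.compContinuousLinearMap (c.dBase x))

open Classical in
/-- The coordinate vector `∂_i ∈ V_y Y`, for `y` in the domain of the fibred chart. -/
def vertVec (y : Y) (i : Fin m) : B.Vert y :=
  if h : c.dTotalSymm (c.total y) (0, stdVec i) ∈ B.vert y then B.mkVert y _ h else 0

/-- The element `dx^λ ⊗ ∂_i` of `T*_{π(y)} X ⊗ V_y Y`. -/
def elemHom (y : Y) (l : Fin n) (i : Fin m) : B.VertHom y :=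
  B.mkHom y
    (((EuclideanSpace.proj l : Eu n →L[ℝ] ℝ).comp (c.dBase (B.proj y))).smulRight (c.vertVec y i))

/-- The linear coordinate `ξ ↦ ξ^i_λ` on `T*_{π(y)} X ⊗ V_y Y`. -/
def homCoord (y : Y) (l : Fin n) (i : Fin m) : (B.VertHom y) →L[ℝ] ℝ :=
  ((EuclideanSpace.proj i : Eu m →L[ℝ] ℝ).comp ((ContinuousLinearMap.snd ℝ (Eu n) (Eu m)).comp
    (c.dTotal y))).comp
    ((ContinuousLinearMap.apply ℝ (TotMod n m) (c.frameX (B.proj y) l)).comp (B.inclHom y))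

theorem homCoord_apply (y : Y) (l : Fin n) (i : Fin m) (xi : B.VertHom y) :
    c.homCoord y l i xi = (c.dTotal y (B.inclHom y xi (c.frameX (B.proj y) l))).2 i := rfl

theorem inclHom_elemHom (y : Y) (l : Fin n) (i : Fin m) (w : Eu n) :
    B.inclHom y (c.elemHom y l i) w =
      (c.dBase (B.proj y) w) l • B.incl y (c.vertVec y i) := by
  rw [elemHom, B.inclHom_mkHom]
  simp

theorem vertVec_coe {y : Y} (hy : y ∈ c.total.source) (i : Fin m) :
    B.incl y (c.vertVec y i) = c.dTotalSymm (c.total y) (0, stdVec i) := by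
  have h : c.dTotalSymm (c.total y) (0, stdVec i) ∈ B.vert y := by
    have := c.dproj_dTotalSymm hy (0, stdVec i)
    rw [map_zero] at this
    exact this
  have h2 : c.vertVec y i = B.mkVert y _ h := dif_pos h
  rw [h2]
  rfl

theorem eq_sum_frameX {x : X} (hx : x ∈ c.base.source) (u : Eu n) :
    u = ∑ l, (c.dBase x u) l • c.frameX x l := by
  conv_lhs => rw [← c.dBaseSymm_dBase hx u, ← sum_stdVec (c.dBase x u)]
  simp [FibChart.frameX]

theorem dBase_frameX {x : X} (hx : x ∈ c.base.source) (l : Fin n) :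
    c.dBase x (c.frameX x l) = stdVec l :=
  c.dBase_dBaseSymm hx _

theorem volX_frameX {x : X} (hx : x ∈ c.base.source) : TopForm.ev (c.frameX x) (c.volX x) = 1 := by
  have h : ⇑(c.dBase x) ∘ c.frameX x = stdVec := by
    funext l
    exact c.dBase_frameX hx l
  change (stdVol n).val (⇑(c.dBase x) ∘ c.frameX x) = 1
  rw [h]
  have h3 : ⇑((EuclideanSpace.basisFun (Fin n) ℝ).toBasis) = (stdVec : Fin n → Eu n) := by
    funext l
    simp [stdVec]
  rw [← h3]
  exact (EuclideanSpace.basisFun (Fin n) ℝ).toBasis.det_self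

theorem topForm_eq_volX {x : X} (hx : x ∈ c.base.source) (al : TopForm n) :
    al = TopForm.ev (c.frameX x) al • c.volX x := by
  refine TopForm.ext fun w => ?_
  set be := TopForm.of (al.val.compContinuousLinearMap (c.dBaseSymm (c.base x))) with hbe
  have h1 : TopForm.ev w al = TopForm.ev (c.dBase x ∘ w) be := by
    change al.val w = al.val (c.dBaseSymm (c.base x) ∘ (c.dBase x ∘ w))
    congr 1
    funext l
    exact (c.dBaseSymm_dBase hx (w l)).symm
  have h2 : TopForm.ev stdVec be = TopForm.ev (c.frameX x) al := rfl
  rw [h1, topForm_eq be, h2]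
  rfl

theorem vert_eq_sum {y : Y} (hy : y ∈ c.total.source) (u : TotMod n m) (hu : B.dproj y u = 0) :
    u = ∑ i, (c.dTotal y u).2 i • B.incl y (c.vertVec y i) := by
  simp only [c.vertVec_coe hy]
  conv_lhs => rw [← c.dTotalSymm_dTotal hy u]
  simp only [← map_smul, ← map_sum]
  congr 1
  refine Prod.ext ?_ ?_
  · rw [c.dTotal_fst hy, hu]
    simp [Prod.fst_sum]
  · rw [Prod.snd_sum]
    simp only [Prod.smul_snd]
    exact (sum_stdVec _).symm

theorem hom_eq_sum {y : Y} (hy : y ∈ c.total.source) (xi : B.VertHom y) :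
    xi = ∑ l, ∑ i, c.homCoord y l i xi • c.elemHom y l i := by
  apply B.inclHom_injective y
  ext1 w
  conv_lhs => rw [c.eq_sum_frameX (c.proj_mem y hy) w, map_sum]
  simp only [map_sum, sum_apply, map_smul, smul_apply, inclHom_elemHom, homCoord_apply]
  refine Finset.sum_congr rfl fun l _ => ?_
  conv_lhs => rw [c.vert_eq_sum hy (B.inclHom y xi (c.frameX (B.proj y) l))
    (B.dproj_inclHom y xi _), Finset.smul_sum]
  exact Finset.sum_congr rfl fun i _ => smul_comm _ _ _

theorem homCoord_elemHom {y : Y} (hy : y ∈ c.total.source) (l l' : Fin n) (i i' : Fin m) :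
    c.homCoord y l i (c.elemHom y l' i') = if l = l' ∧ i = i' then 1 else 0 := by
  have hx := c.proj_mem y hy
  rw [homCoord_apply, inclHom_elemHom, c.dBase_frameX hx, map_smul, c.vertVec_coe hy,
    c.dTotal_dTotalSymm hy]
  by_cases h1 : l = l' <;> by_cases h2 : i = i' <;> simp [stdVec, h1, h2, eq_comm]

/-- The coordinates `(x^λ, y^i, p^λ_i)` on `Π`: an element of the fibre over `y` maps
`ξ = ξ^i_λ dx^λ ⊗ ∂_i` to `p^λ_i ξ^i_λ ω`. -/
def momentumChart : PartialEquiv (Momentum B) (TotMod n m × Arr n m) where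
  toFun q := (c.total q.point,
    fun l i => TopForm.ev (c.frameX (B.proj q.point)) (q.form (c.elemHom q.point l i)))
  invFun w :=
    { point := c.total.symm w.1
      form := ∑ l, ∑ i, (w.2 l i • c.homCoord (c.total.symm w.1) l i).smulRight
        (c.volX (B.proj (c.total.symm w.1))) }
  source := {q | q.point ∈ c.total.source}
  target := c.total.target ×ˢ univ
  map_source' q hq := ⟨c.total.map_source hq, mem_univ _⟩
  map_target' w hw := c.total.map_target hw.1
  left_inv' q hq := by
    obtain ⟨y, et⟩ := q
    have hy : y ∈ c.total.source := hq
    simp only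
    congr 1
    · exact c.total.left_inv hy
    · rw [c.total.left_inv hy]
      refine heq_of_eq ?_
      ext1 xi
      conv_rhs => rw [c.hom_eq_sum hy xi]
      simp only [sum_apply, map_sum, map_smul,
        ContinuousLinearMap.smulRight_apply, smul_apply]
      refine Finset.sum_congr rfl fun l _ => Finset.sum_congr rfl fun i _ => ?_
      conv_rhs => rw [c.topForm_eq_volX (c.proj_mem y hy) (et (c.elemHom y l i))]
      rw [smul_smul, smul_eq_mul, mul_comm]
  right_inv' w hw := by
    obtain ⟨a, p⟩ := w
    have h : a ∈ c.total.target := hw.1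
    have hy := c.total.map_target h
    refine Prod.ext (c.total.right_inv h) ?_
    funext l i
    simp only [sum_apply, ContinuousLinearMap.smulRight_apply,
      smul_apply, c.homCoord_elemHom hy, smul_eq_mul]
    rw [Finset.sum_eq_single l, Finset.sum_eq_single i]
    · simp [c.volX_frameX (c.proj_mem _ hy)]
    · intro b _ hb
      simp [hb]
    · simp
    · intro b _ hb
      simp [hb]
    · simp

end FibChart

/-- The manifold topology of `Π`: a set is open if and only if it is open in all coordinate
systems `(x^λ, y^i, p^λ_i)`. -/
instance momentumTopology (B : FibBundle n m X Y F) : TopologicalSpace (Momentum B) :=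
  ⨆ c : FibChart B, TopologicalSpace.coinduced
    (fun w : c.total.target × Arr n m => c.momentumChart.symm ((w.1 : TotMod n m), w.2))
    inferInstance

/-! ## Partial derivatives of coordinate expressions -/

/-- The derivative `∂_i = ∂/∂y^i` of a function of `(x^λ, y^i, y^i_λ)` or of `(x^λ, y^i, p^λ_i)`. -/
def partialY (i : Fin m) (f : TotMod n m × Arr n m → ℝ) (w : TotMod n m × Arr n m) : ℝ :=
  fderiv ℝ f w ((0, stdVec i), 0)

/-- The derivative `∂^λ_i = ∂/∂y^i_λ` of a function of `(x^λ, y^i, y^i_λ)`, or the derivative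
`∂^i_λ = ∂/∂p^λ_i` of a function of `(x^λ, y^i, p^λ_i)`. -/
def partialA (l : Fin n) (i : Fin m) (f : TotMod n m × Arr n m → ℝ)
    (w : TotMod n m × Arr n m) : ℝ :=
  fderiv ℝ f w (0, stdArr l i)

/-- The derivative `∂/∂x^λ` of a function on `ℝⁿ`. -/
def partialX (l : Fin n) (f : Eu n → ℝ) (t : Eu n) : ℝ := fderiv ℝ f t (stdVec l)

/-! ## Sections -/

/-- `s` is a smooth section of `Y → X` over `U`. -/
def FibBundle.IsSection (B : FibBundle n m X Y F) (U : Set X) (s : X → Y) : Prop :=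
  (∀ x ∈ U, B.proj (s x) = x) ∧ ContMDiffOn 𝓘(ℝ, Eu n) 𝓘(ℝ, TotMod n m) ∞ s U

/-- `σ` is a smooth section of `J¹Y → X` over `U`. -/
def FibBundle.IsJetSection (B : FibBundle n m X Y F) (U : Set X) (sg : X → Jet B) : Prop :=
  B.IsSection U (fun x => (sg x).point) ∧
  ∀ c : FibChart B, ∀ x ∈ U, (sg x).point ∈ c.total.source →
    ContMDiffAt 𝓘(ℝ, Eu n) 𝓘(ℝ, TotMod n m × Arr n m) ∞ (fun x' => c.jetChart (sg x')) x

/-- `r` is a smooth section of `Π → X` over `U`. -/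
def FibBundle.IsMomentumSection (B : FibBundle n m X Y F) (U : Set X) (r : X → Momentum B) :
    Prop :=
  B.IsSection U (fun x => (r x).point) ∧
  ∀ c : FibChart B, ∀ x ∈ U, (r x).point ∈ c.total.source →
    ContMDiffAt 𝓘(ℝ, Eu n) 𝓘(ℝ, TotMod n m × Arr n m) ∞ (fun x' => c.momentumChart (r x')) x

/-! ## Lagrangians -/

/-- The coordinate expression `𝓛(x^λ, y^i, y^i_λ)` of a map `L : J¹Y → ⋀ⁿT*X` over `X`:
`L = 𝓛 ω`, `ω = dx¹ ∧ … ∧ dxⁿ`. -/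
def FibChart.lagrExpr {B : FibBundle n m X Y F} (c : FibChart B) (L : Jet B → TopForm n)
    (w : TotMod n m × Arr n m) : ℝ :=
  TopForm.ev (c.frameX (B.proj (c.jetChart.symm w).point)) (L (c.jetChart.symm w))

/-- A smooth first order Lagrangian `L : J¹Y → ⋀ⁿT*X` over `X`. -/
structure Lagrangian (B : FibBundle n m X Y F) where
  /-- the value at a jet `z` at `y` is an element of `⋀ⁿT*_{π(y)} X` -/
  toFun : Jet B → TopForm n
  smooth : ∀ c : FibChart B, ContDiffOn ℝ ∞ (c.lagrExpr toFun) (c.total.target ×ˢ univ)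

namespace Lagrangian

variable {B : FibBundle n m X Y F} (L : Lagrangian B)

/-- The coordinate expression `𝓛` of a Lagrangian. -/
abbrev expr (c : FibChart B) : TotMod n m × Arr n m → ℝ := c.lagrExpr L.toFun

/-- The Legendre map `L̂ : J¹Y → Π`, the fibre derivative of `L`; in coordinates
`p^λ_i ∘ L̂ = ∂^λ_i 𝓛`. -/
def legendre (z : Jet B) : Momentum B :=
  ⟨z.point, fderiv ℝ (fun xi : B.VertHom z.point => L.toFun (z.shift xi)) 0⟩

/-- The Lagrangian constraint space `N_L = L̂(J¹Y) ⊆ Π`. -/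
def constraintSpace : Set (Momentum B) := range L.legendre

/-- The coordinate expression `(∂^λ_i 𝓛)_{λ,i}` of the momenta `p^λ_i ∘ L̂`, read off from `L̂`. -/
def legendreExpr (c : FibChart B) (w : TotMod n m × Arr n m) : Arr n m :=
  (c.momentumChart (L.legendre (c.jetChart.symm w))).2

/-- The section `s` of `Y → X` over `U` is a solution of the Euler-Lagrange equations
`(∂_i - d_λ ∂^λ_i) 𝓛 = 0`. -/
def SolvesEulerLagrange (U : Set X) (s : X → Y) : Prop :=
  B.IsSection U s ∧
  ∀ c : FibChart B, ∀ x ∈ U, s x ∈ c.total.source → ∀ i : Fin m,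
    let j : Eu n → TotMod n m × Arr n m := fun t => c.jetChart (B.prolong s (c.base.symm t))
    partialY i (L.expr c) (j (c.base x))
      - ∑ l, partialX l (fun t => partialA l i (L.expr c) (j t)) (c.base x) = 0

/-- The section `σ` of `J¹Y → X` over `U` is a solution of the Cartan equations
`∂^λ_i π^μ_j (ŷ^j_μ - y^j_μ) = 0`, `∂_i 𝓛 - d̂_λ π^λ_i + (ŷ^j_λ - y^j_λ) ∂_i π^λ_j = 0`, where
`π^λ_i = ∂^λ_i 𝓛` and, along `J¹σ`, `ŷ^j_μ` is `∂(y^j ∘ σ)/∂x^μ` and `d̂_λ π^λ_i` is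
`∂(π^λ_i ∘ σ)/∂x^λ`. -/
def SolvesCartan (U : Set X) (sg : X → Jet B) : Prop :=
  B.IsJetSection U sg ∧
  ∀ c : FibChart B, ∀ x ∈ U, (sg x).point ∈ c.total.source →
    let j : Eu n → TotMod n m × Arr n m := fun t => c.jetChart (sg (c.base.symm t))
    let yhat : Fin n → Fin m → ℝ := fun l i => partialX l (fun t => (j t).1.2 i) (c.base x)
    let y : Fin n → Fin m → ℝ := (j (c.base x)).2
    let pi : Fin n → Fin m → TotMod n m × Arr n m → ℝ := fun l i => partialA l i (L.expr c)
    (∀ (l : Fin n) (i : Fin m),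
      ∑ k, ∑ h, partialA l i (pi k h) (j (c.base x)) * (yhat k h - y k h) = 0) ∧
    ∀ i : Fin m,
      partialY i (L.expr c) (j (c.base x))
        - ∑ l, partialX l (fun t => pi l i (j t)) (c.base x)
        + ∑ l, ∑ h, (yhat l h - y l h) * partialY i (pi l h) (j (c.base x)) = 0

end Lagrangian

/-! ## Almost-regular Lagrangians -/

/-- A local trivialization of a subset `N ⊆ Π` as an imbedded subbundle of `Π → Y`, over the domain
`W` of a fibred chart, with typical fibre the manifold `Q`: a smooth imbedding `W × Q → Π` over `W`,
here written in coordinates as `(a, f) ↦ (a, e(a, f))`, whose image is the part of `N` over `W`. -/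
structure SubbundleTriv {B : FibBundle n m X Y F} (N : Set (Momentum B)) (c : FibChart B) (k : ℕ)
    (Q : Type) [TopologicalSpace Q] [ChartedSpace (Eu k) Q] where
  /-- the map `e` -/
  toFun : TotMod n m × Q → Arr n m
  smooth : ContMDiffOn (𝓘(ℝ, TotMod n m).prod 𝓘(ℝ, Eu k)) 𝓘(ℝ, Arr n m) ∞ toFun
    (c.total.target ×ˢ univ)
  range_eq : ∀ a ∈ c.total.target,
    range (fun f : Q => toFun (a, f)) = {p : Arr n m | c.momentumChart.symm (a, p) ∈ N}
  immersion : ∀ a ∈ c.total.target, ∀ f : Q,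
    Function.Injective (mfderiv 𝓘(ℝ, Eu k) 𝓘(ℝ, Arr n m) (fun f' : Q => toFun (a, f')) f)
  embedding : Topology.IsEmbedding
    (fun w : c.total.target × Q => ((w.1 : TotMod n m), toFun ((w.1 : TotMod n m), w.2)))

/-- In a local trivialization `W × Q` of `N_L`, the Legendre map from the part of `J¹Y` over `W` to
`N_L` is a smooth submersion.  As it is a map over `W`, in coordinates `(a, v) ↦ (a, g(a, v))`, it
is a submersion if and only if the partial differentials of `g` along the fibres are onto. -/
def Lagrangian.IsSubmersionIn {B : FibBundle n m X Y F} (L : Lagrangian B) {c : FibChart B}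
    {k : ℕ} {Q : Type} [TopologicalSpace Q] [ChartedSpace (Eu k) Q]
    (T : SubbundleTriv L.constraintSpace c k Q) : Prop :=
  ∃ g : TotMod n m × Arr n m → Q,
    (∀ a ∈ c.total.target, ∀ v : Arr n m, T.toFun (a, g (a, v)) = L.legendreExpr c (a, v)) ∧
    ContMDiffOn 𝓘(ℝ, TotMod n m × Arr n m) 𝓘(ℝ, Eu k) ∞ g (c.total.target ×ˢ univ) ∧
    ∀ a ∈ c.total.target, ∀ v : Arr n m,
      Function.Surjective (mfderiv 𝓘(ℝ, Arr n m) 𝓘(ℝ, Eu k) (fun v' => g (a, v')) v)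

/-- `L` is almost-regular: `N_L` is a closed imbedded subbundle of `Π → Y`, and `L̂ : J¹Y → N_L` is
a fibred manifold (a surjective submersion) with connected fibres.  (The fibre over a point of `Π`
at `y` is a subset of the affine space `J¹_y Y` of linear maps `T_{π(y)} X → T_y Y`.) -/
structure Lagrangian.IsAlmostRegular {B : FibBundle n m X Y F} (L : Lagrangian B) : Prop where
  closed : IsClosed L.constraintSpace
  fibred : ∀ y : Y, ∃ c : FibChart B, y ∈ c.total.source ∧
    ∃ (k : ℕ) (Q : Type) (_ : TopologicalSpace Q) (_ : ChartedSpace (Eu k) Q)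
      (_ : IsManifold 𝓘(ℝ, Eu k) ∞ Q) (T : SubbundleTriv L.constraintSpace c k Q),
      L.IsSubmersionIn T
  connected : ∀ q ∈ L.constraintSpace, IsConnected (Jet.lin '' {z : Jet B | L.legendre z = q})

/-! ## Hamiltonians -/

/-- `α ∈ ⋀ⁿT*_y Y` belongs to the fibre of the homogeneous Legendre bundle
`Z_Y = T*Y ∧ ⋀ⁿ⁻¹T*X`: it vanishes on any two vertical vectors. -/
def FibBundle.InHomLegendre (B : FibBundle n m X Y F) (y : Y)
    (al : (TotMod n m) [⋀^Fin n]→L[ℝ] ℝ) : Prop :=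
  ∀ (u : Fin n → TotMod n m) (l k : Fin n), l ≠ k → u l ∈ B.vert y → u k ∈ B.vert y → al u = 0

/-- `α = p ω + p^λ_i dy^i ∧ ω_λ` in `Z_Y` lies over the point `q = (p^λ_i)` of `Π`.  The pull-back
of `α` by a jet is `(p + p^λ_i y^i_λ) ω`, an affine function of the jet, and `q ∈ Hom(T*X ⊗ VY,
⋀ⁿT*X)` is its linear part. -/
def FibBundle.LiesOver (B : FibBundle n m X Y F) (al : (TotMod n m) [⋀^Fin n]→L[ℝ] ℝ)
    (q : Momentum B) : Prop :=
  ∀ (G : Eu n →L[ℝ] TotMod n m), (B.dproj q.point).comp G = ContinuousLinearMap.id ℝ (Eu n) →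
    ∀ xi : B.VertHom q.point,
      TopForm.of (al.compContinuousLinearMap (G + B.inclHom q.point xi))
        - TopForm.of (al.compContinuousLinearMap G) = q.form xi

/-- The coordinate expression `ℋ(x^λ, y^i, p^λ_i)` of a map `h : Π → ⋀ⁿT*Y` over `Y`, defined by
`p ∘ h = -ℋ`, where `p` is the coefficient of `ω`. -/
def FibChart.hamExpr {B : FibBundle n m X Y F} (c : FibChart B)
    (h : Momentum B → (TotMod n m) [⋀^Fin n]→L[ℝ] ℝ) (w : TotMod n m × Arr n m) : ℝ :=
  -(h (c.momentumChart.symm w) (c.frameY (c.momentumChart.symm w).point))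

/-- A Hamiltonian: a smooth section of `Z_Y → Π`. -/
structure Hamiltonian (B : FibBundle n m X Y F) where
  /-- the value at a point `q` of `Π` at `y` is an element of `⋀ⁿT*_y Y` -/
  toFun : Momentum B → (TotMod n m) [⋀^Fin n]→L[ℝ] ℝ
  mem : ∀ q, B.InHomLegendre q.point (toFun q)
  liesOver : ∀ q, B.LiesOver (toFun q) q
  smooth : ∀ c : FibChart B, ContDiffOn ℝ ∞ (c.hamExpr toFun) (c.total.target ×ˢ univ)

/-- For a finite-dimensional `W`, every linear map `Hom(W, ⋀ⁿ) → ⋀ⁿ` is the evaluation at an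
element of `W`. -/
theorem exists_eval {W : Type*} [NormedAddCommGroup W] [NormedSpace ℝ W] [FiniteDimensional ℝ W]
    (D : (W →L[ℝ] TopForm n) →L[ℝ] TopForm n) : ∃ xi : W, ∀ et, et xi = D et := by
  let ph : Module.Dual ℝ (Module.Dual ℝ W) :=
    { toFun := fun f =>
        TopForm.ev stdVec (D ((LinearMap.toContinuousLinearMap f).smulRight (stdVol n)))
      map_add' := by
        intro f g
        have : (LinearMap.toContinuousLinearMap (f + g)).smulRight (stdVol n) =
          (LinearMap.toContinuousLinearMap f).smulRight (stdVol n) +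
          (LinearMap.toContinuousLinearMap g).smulRight (stdVol n) := by
          ext1 w
          simp [add_smul]
        rw [this, map_add, map_add]
      map_smul' := by
        intro r f
        have : (LinearMap.toContinuousLinearMap (r • f)).smulRight (stdVol n) =
          r • (LinearMap.toContinuousLinearMap f).smulRight (stdVol n) := by
          ext1 w
          simp [mul_smul]
        rw [this, map_smul, map_smul]; rfl }
  obtain ⟨xi, hxi⟩ := (Module.evalEquiv ℝ W).surjective ph
  refine ⟨xi, fun et => ?_⟩
  let f : Module.Dual ℝ W :=
    { toFun := fun w => TopForm.ev stdVec (et w)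
      map_add' := by intro a b; rw [map_add, map_add]
      map_smul' := by intro r a; rw [map_smul, map_smul]; rfl }
  have h1 : et = (LinearMap.toContinuousLinearMap f).smulRight (stdVol n) := by
    ext1 w
    exact topForm_eq (et w)
  have h2 : f xi = TopForm.ev stdVec (D et) := by
    have := DFunLike.congr_fun hxi f
    rw [h1]
    exact this
  rw [topForm_eq (et xi), topForm_eq (D et), ← h2]
  rfl

namespace Hamiltonian

variable {B : FibBundle n m X Y F} (H : Hamiltonian B)

/-- The coordinate expression `ℋ` of a Hamiltonian. -/
abbrev expr (c : FibChart B) : TotMod n m × Arr n m → ℝ := c.hamExpr H.toFun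

/-- The jet `z` is the value at `q` of the Hamiltonian map: it is a jet at the same point `y` of
`Y`, and the fibre derivative at `q` of the pull-back `z*H = (p^λ_i y^i_λ - ℋ) ω` of the Hamiltonian
form vanishes, that is, `y^i_λ(z) = ∂^i_λ ℋ(q)`. -/
def IsMapValue (q : Momentum B) (z : Jet B) : Prop :=
  z.point = q.point ∧
  fderiv ℝ (fun et : B.MomFibre q.point =>
    (z.pull (H.toFun ⟨q.point, et⟩) : TopForm n)) q.form = 0

theorem exists_isMapValue (q : Momentum B) : ∃ z : Jet B, H.IsMapValue q z := by
  obtain ⟨y, et0⟩ := q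
  set z0 : Jet B := B.someJet y with hz0
  set D := fderiv ℝ (fun et : B.MomFibre y =>
    (z0.pull (H.toFun ⟨y, et⟩) : TopForm n)) et0 with hD
  obtain ⟨xi, hxi⟩ := exists_eval (-D)
  refine ⟨z0.shift xi, rfl, ?_⟩
  have hfun : (fun et : B.MomFibre y =>
      ((z0.shift xi).pull (H.toFun ⟨y, et⟩) : TopForm n)) =
      fun et => z0.pull (H.toFun ⟨y, et⟩) + et xi := by
    funext et
    have := H.liesOver ⟨y, et⟩ z0.lin z0.dproj_lin xi
    rw [sub_eq_iff_eq_add'] at this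
    exact this
  have hev : DifferentiableAt ℝ
      (fun et : B.MomFibre y => et xi) et0 := by fun_prop
  change fderiv ℝ (fun et : B.MomFibre y =>
      ((z0.shift xi).pull (H.toFun ⟨y, et⟩) : TopForm n)) et0 = 0
  rw [hfun]
  by_cases hd : DifferentiableAt ℝ (fun et : B.MomFibre y =>
    (z0.pull (H.toFun ⟨y, et⟩) : TopForm n)) et0
  · rw [fderiv_fun_add hd hev, ← hD]
    have : fderiv ℝ (fun et : B.MomFibre y => et xi) et0 =
        ContinuousLinearMap.apply ℝ (TopForm n) xi :=
      (ContinuousLinearMap.apply ℝ (TopForm n) xi).fderiv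
    rw [this]
    ext1 et
    have h := hxi et
    simp [h]
  · refine fderiv_zero_of_not_differentiableAt fun hh => hd ?_
    refine (hh.sub hev).congr_of_eventuallyEq (Filter.Eventually.of_forall fun et => ?_)
    simp

/-- The Hamiltonian map `Ĥ : Π → J¹Y` over `Y`; in coordinates `y^i_λ ∘ Ĥ = ∂^i_λ ℋ`. -/
def map (q : Momentum B) : Jet B := (H.exists_isMapValue q).choose

/-- The Hamiltonian `ℋ` is associated to `L`: at the points of `N_L` one has `L̂ ∘ Ĥ = Id`, i.e.
`p^μ_i = ∂^μ_i 𝓛(x^μ, y^i, ∂^j_λ ℋ)`, and `p^μ_i ∂^i_μ ℋ - ℋ = 𝓛(x^μ, y^j, ∂^j_λ ℋ)`. -/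
def IsAssociated (L : Lagrangian B) : Prop :=
  (∀ q ∈ L.constraintSpace, L.legendre (H.map q) = q) ∧
  ∀ c : FibChart B, ∀ q ∈ L.constraintSpace, q.point ∈ c.total.source →
    let w : TotMod n m × Arr n m := c.momentumChart q
    ∑ l, ∑ i, w.2 l i * partialA l i (H.expr c) w - H.expr c w =
      L.expr c (w.1, fun l i => partialA l i (H.expr c) w)

/-- The section `r` of `Π → X` over `U` is a solution of the Hamilton equations
`y^i_λ = ∂^i_λ ℋ`, `p^λ_{λ i} = -∂_i ℋ`. -/
def SolvesHamilton (U : Set X) (r : X → Momentum B) : Prop :=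
  B.IsMomentumSection U r ∧
  ∀ c : FibChart B, ∀ x ∈ U, (r x).point ∈ c.total.source →
    let j : Eu n → TotMod n m × Arr n m := fun t => c.momentumChart (r (c.base.symm t))
    (∀ (l : Fin n) (i : Fin m),
      partialX l (fun t => (j t).1.2 i) (c.base x) = partialA l i (H.expr c) (j (c.base x))) ∧
    ∀ i : Fin m,
      ∑ l, partialX l (fun t => (j t).2 l i) (c.base x) = -partialY i (H.expr c) (j (c.base x))

end Hamiltonian

/-! ## Consistency of the definitions with the coordinate formulas -/

section Coord
variable {B : FibBundle n m X Y F} (c : FibChart B)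

/-- The coordinates `(ξ^i_λ)` on `T*X ⊗ VY`, as an array. -/
def FibChart.homArr (y : Y) : B.VertHom y →L[ℝ] Arr n m :=
  ContinuousLinearMap.pi fun l => ContinuousLinearMap.pi fun i => c.homCoord y l i

theorem FibChart.homArr_elemHom {y : Y} (hy : y ∈ c.total.source) (l : Fin n) (i : Fin m) :
    c.homArr y (c.elemHom y l i) = stdArr l i := by
  funext l' i'
  change c.homCoord y l' i' (c.elemHom y l i) = _
  rw [c.homCoord_elemHom hy]
  by_cases h1 : l' = l
  · subst h1
    by_cases h2 : i' = i
    · subst h2; simp [stdArr]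
    · simp [stdArr, h2]
  · simp [stdArr, h1]

theorem FibChart.jetChart_symm (w : TotMod n m × Arr n m) (h : w.1 ∈ c.total.target) :
    c.jetChart.symm w =
      { point := c.total.symm w.1
        lin := (c.dTotalSymm w.1).comp
          (((ContinuousLinearMap.id ℝ (Eu n)).prod (arrMap w.2)).comp
            (c.dBase (B.proj (c.total.symm w.1))))
        dproj_lin := c.dproj_symm_lin w h } :=
  dif_pos h

theorem FibChart.jetChart_shift (z : Jet B) (xi : B.VertHom z.point) :
    c.jetChart (z.shift xi) = c.jetChart z + (0, c.homArr z.point xi) := by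
  refine Prod.ext ?_ ?_
  · simp [FibChart.jetChart, Jet.shift]
  · funext l i
    change (c.dTotal z.point ((z.lin + B.inclHom z.point xi) (c.frameX (B.proj z.point) l))).2 i = _
    simp only [add_apply, map_add]
    rfl

theorem Lagrangian.ev_toFun (L : Lagrangian B) {z : Jet B} (hz : z.point ∈ c.total.source) :
    TopForm.ev (c.frameX (B.proj z.point)) (L.toFun z) = L.expr c (c.jetChart z) := by
  have : c.jetChart.symm (c.jetChart z) = z := c.jetChart.left_inv hz
  simp only [FibChart.lagrExpr]
  rw [this]

/-- The coordinate formula `p^λ_i ∘ L̂ = ∂^λ_i 𝓛`. -/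
theorem Lagrangian.momentumChart_legendre (L : Lagrangian B) {z : Jet B}
    (hz : z.point ∈ c.total.source) :
    c.momentumChart (L.legendre z) =
      (c.total z.point, fun l i => partialA l i (L.expr c) (c.jetChart z)) := by
  have hx := c.proj_mem _ hz
  have hmem : c.jetChart z ∈ c.total.target ×ˢ (univ : Set (Arr n m)) := c.jetChart.map_source hz
  have hopen : IsOpen (c.total.target ×ˢ (univ : Set (Arr n m))) :=
    c.total.open_target.prod isOpen_univ
  have hL : HasFDerivAt (L.expr c) (fderiv ℝ (L.expr c) (c.jetChart z)) (c.jetChart z) :=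
    (((L.smooth c).contDiffAt (hopen.mem_nhds hmem)).differentiableAt (by simp)).hasFDerivAt
  have hj : HasFDerivAt (fun xi : B.VertHom z.point => c.jetChart z + ((0 : TotMod n m), c.homArr z.point xi))
      ((0 : B.VertHom z.point →L[ℝ] TotMod n m).prod (c.homArr z.point)) 0 :=
    ((hasFDerivAt_const (0 : TotMod n m) _).prodMk (c.homArr z.point).hasFDerivAt).const_add _
  have hcomp : HasFDerivAt (fun xi : B.VertHom z.point => L.expr c (c.jetChart (z.shift xi)))
      ((fderiv ℝ (L.expr c) (c.jetChart z)).comp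
        ((0 : B.VertHom z.point →L[ℝ] TotMod n m).prod (c.homArr z.point))) 0 := by
    simp only [c.jetChart_shift]
    refine HasFDerivAt.comp (g := L.expr c) (0 : B.VertHom z.point) ?_ hj
    have h0 : c.jetChart z + ((0 : TotMod n m), c.homArr z.point 0) = c.jetChart z := by
      rw [map_zero]; exact add_zero _
    rw [h0]; exact hL
  have hfun : (fun xi : B.VertHom z.point => L.toFun (z.shift xi)) =
      fun xi => L.expr c (c.jetChart (z.shift xi)) • c.volX (B.proj z.point) := by
    funext xi
    rw [c.topForm_eq_volX hx (L.toFun (z.shift xi))]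
    congr 1
    exact L.ev_toFun c (z := z.shift xi) hz
  refine Prod.ext rfl ?_
  funext l i
  change TopForm.ev (c.frameX (B.proj z.point))
    (fderiv ℝ (fun xi : B.VertHom z.point => L.toFun (z.shift xi)) 0 (c.elemHom z.point l i)) = _
  rw [hfun, (hcomp.smul_const _).fderiv]
  simp [c.volX_frameX hx, c.homArr_elemHom hz, partialA]

/-- The coordinate formula `z*H = (p^λ_i y^i_λ - ℋ) ω`. -/
theorem Hamiltonian.ev_pull (H : Hamiltonian B) {z : Jet B} (hz : z.point ∈ c.total.source)
    (et : B.MomFibre z.point) :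
    TopForm.ev (c.frameX (B.proj z.point)) (z.pull (H.toFun ⟨z.point, et⟩)) =
      ∑ l, ∑ i, (c.momentumChart ⟨z.point, et⟩).2 l i * (c.jetChart z).2 l i
        - H.expr c (c.momentumChart ⟨z.point, et⟩) := by
  have hx := c.proj_mem _ hz
  set w0 : TotMod n m × Arr n m := (c.total z.point, 0) with hw0
  have hw0t : w0.1 ∈ c.total.target := c.total.map_source hz
  set z0 : Jet B := c.jetChart.symm w0 with hz0
  have hz0e : z0.point = z.point := by
    rw [hz0, c.jetChart_symm w0 hw0t]
    exact c.total.left_inv hz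
  have hz0l : z0.lin = (c.dTotalSymm w0.1).comp
          (((ContinuousLinearMap.id ℝ (Eu n)).prod (arrMap w0.2)).comp
            (c.dBase (B.proj (c.total.symm w0.1)))) := by
    rw [hz0, c.jetChart_symm w0 hw0t]
  have hframe : ∀ l, z0.lin (c.frameX (B.proj z.point) l) = c.frameY z.point l := by
    intro l
    rw [hz0l]
    simp only [ContinuousLinearMap.comp_apply, ContinuousLinearMap.prod_apply,
      ContinuousLinearMap.id_apply]
    have : c.total.symm w0.1 = z.point := c.total.left_inv hz
    rw [this, c.dBase_frameX hx]
    simp [hw0, FibChart.frameY, arrMap]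
  have hd : (B.dproj z.point).comp z0.lin = ContinuousLinearMap.id ℝ (Eu n) := by
    rw [← hz0e]; exact z0.dproj_lin
  have hver : ∀ w, z.lin w - z0.lin w ∈ B.vert z.point := by
    intro w
    have h1 := DFunLike.congr_fun hd w
    have h2 := DFunLike.congr_fun z.dproj_lin w
    simp only [ContinuousLinearMap.comp_apply, ContinuousLinearMap.id_apply] at h1 h2
    change B.dproj z.point (z.lin w - z0.lin w) = 0
    rw [map_sub, h1, h2, sub_self]
  let xi : B.VertHom z.point := B.mkHom z.point ((z.lin - z0.lin).codRestrict (B.vert z.point) hver)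
  have hxi : z.lin = z0.lin + B.inclHom z.point xi := by
    ext1 w
    have : B.inclHom z.point xi w = z.lin w - z0.lin w := rfl
    rw [add_apply, this]; abel
  have ho := H.liesOver ⟨z.point, et⟩ z0.lin hd xi
  have ho2 := congrArg (TopForm.ev (c.frameX (B.proj z.point))) ho
  rw [map_sub] at ho2
  have e1 : TopForm.ev (c.frameX (B.proj z.point))
      (TopForm.of ((H.toFun ⟨z.point, et⟩).compContinuousLinearMap (z0.lin + B.inclHom z.point xi))) =
      TopForm.ev (c.frameX (B.proj z.point)) (z.pull (H.toFun ⟨z.point, et⟩)) := by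
    rw [Jet.pull, hxi]
  have e2 : TopForm.ev (c.frameX (B.proj z.point))
      (TopForm.of ((H.toFun ⟨z.point, et⟩).compContinuousLinearMap z0.lin)) =
      - H.expr c (c.momentumChart ⟨z.point, et⟩) := by
    have hl : c.momentumChart.symm (c.momentumChart ⟨z.point, et⟩) = ⟨z.point, et⟩ :=
      c.momentumChart.left_inv hz
    simp only [FibChart.hamExpr]
    rw [hl, neg_neg]
    change (H.toFun ⟨z.point, et⟩) (fun l => z0.lin (c.frameX (B.proj z.point) l)) = _
    congr 1
    funext l
    exact hframe l
  have e3 : TopForm.ev (c.frameX (B.proj z.point)) (et xi) =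
      ∑ l, ∑ i, (c.momentumChart ⟨z.point, et⟩).2 l i * (c.jetChart z).2 l i := by
    conv_lhs => rw [c.hom_eq_sum hz xi]
    simp only [map_sum, map_smul, smul_eq_mul]
    refine Finset.sum_congr rfl fun l _ => Finset.sum_congr rfl fun i _ => ?_
    rw [mul_comm]
    congr 1
    rw [FibChart.homCoord_apply]
    have : B.inclHom z.point xi (c.frameX (B.proj z.point) l) =
      z.lin (c.frameX (B.proj z.point) l) - c.frameY z.point l := by
      rw [← hframe]; rfl
    rw [this, map_sub, FibChart.frameY, c.dTotal_dTotalSymm hz]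
    simp [FibChart.jetChart]
  rw [e1, e2] at ho2
  have e4 : (⟨z.point, et⟩ : Momentum B).form = et := rfl
  rw [e4, e3] at ho2
  linarith

/-- The coordinates `(p^λ_i)` on a fibre of `Π → Y`, as an array. -/
def FibChart.momArr (y : Y) : B.MomFibre y →L[ℝ] Arr n m :=
  ContinuousLinearMap.pi fun l => ContinuousLinearMap.pi fun i =>
    (TopForm.ev (c.frameX (B.proj y))).comp
      (ContinuousLinearMap.apply ℝ (TopForm n) (c.elemHom y l i))

theorem FibChart.momentumChart_mk (y : Y) (et : B.MomFibre y) :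
    c.momentumChart ⟨y, et⟩ = (c.total y, c.momArr y et) := rfl

/-- The coordinate formula `y^i_λ ∘ Ĥ = ∂^i_λ ℋ`. -/
theorem Hamiltonian.jetChart_map (H : Hamiltonian B) {q : Momentum B}
    (hq : q.point ∈ c.total.source) :
    c.jetChart (H.map q) =
      (c.total q.point, fun l i => partialA l i (H.expr c) (c.momentumChart q)) := by
  obtain ⟨h1, h2⟩ := (H.exists_isMapValue q).choose_spec
  change (H.map q).point = q.point at h1
  change fderiv ℝ (fun et : B.MomFibre q.point =>
    ((H.map q).pull (H.toFun ⟨q.point, et⟩) : TopForm n)) q.form = 0 at h2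
  generalize H.map q = z at h1 h2
  obtain ⟨y, et0⟩ := q
  obtain ⟨y', G, hG⟩ := z
  simp only at h1 h2 hq ⊢
  subst h1
  set z : Jet B := ⟨y', G, hG⟩ with hzdef
  have hz : z.point ∈ c.total.source := hq
  have hx := c.proj_mem _ hz
  have hv : TopForm.ev (c.frameX (B.proj y')) (c.volX (B.proj y')) = 1 := c.volX_frameX hx
  have hce := fun l l' i i' => c.homCoord_elemHom (y := y') hz l l' i i'
  have hmem : (c.total y', c.momArr y' et0) ∈ c.total.target ×ˢ (univ : Set (Arr n m)) :=
    ⟨c.total.map_source hz, mem_univ _⟩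
  have hopen : IsOpen (c.total.target ×ˢ (univ : Set (Arr n m))) :=
    c.total.open_target.prod isOpen_univ
  have hH : HasFDerivAt (H.expr c) (fderiv ℝ (H.expr c) (c.total y', c.momArr y' et0))
      (c.total y', c.momArr y' et0) :=
    (((H.smooth c).contDiffAt (hopen.mem_nhds hmem)).differentiableAt (by simp)).hasFDerivAt
  have hp : HasFDerivAt (fun et : B.MomFibre y' => (c.total y', c.momArr y' et))
      ((0 : B.MomFibre y' →L[ℝ] TotMod n m).prod (c.momArr y')) et0 :=
    (hasFDerivAt_const _ _).prodMk (c.momArr y').hasFDerivAt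
  have hlin : HasFDerivAt (fun et : B.MomFibre y' =>
      ∑ l, ∑ i, c.momArr y' et l i * (c.jetChart z).2 l i)
      (∑ l, ∑ i, (c.jetChart z).2 l i • ((ContinuousLinearMap.proj i).comp
        ((ContinuousLinearMap.proj l).comp (c.momArr y')) : B.MomFibre y' →L[ℝ] ℝ)) et0 := by
    refine HasFDerivAt.fun_sum fun l _ => HasFDerivAt.fun_sum fun i _ => ?_
    exact (((ContinuousLinearMap.proj (R := ℝ) (φ := fun _ : Fin m => ℝ) i).comp
        ((ContinuousLinearMap.proj (R := ℝ) (φ := fun _ : Fin n => Fin m → ℝ) l).comp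
          (c.momArr y')) : B.MomFibre y' →L[ℝ] ℝ).hasFDerivAt).mul_const _
  have hcomp := hlin.sub (HasFDerivAt.comp (g := H.expr c) et0 hH hp)
  have hfun : (fun et : B.MomFibre y' => (z.pull (H.toFun ⟨y', et⟩) : TopForm n)) =
      fun et => (∑ l, ∑ i, c.momArr y' et l i * (c.jetChart z).2 l i
        - H.expr c (c.total y', c.momArr y' et)) • c.volX (B.proj y') := by
    funext et
    rw [c.topForm_eq_volX hx (z.pull (H.toFun ⟨y', et⟩))]
    congr 1
    exact H.ev_pull c hz et
  rw [hfun] at h2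
  have h3 := (hcomp.smul_const (c.volX (B.proj y'))).fderiv
  have h4 := h3.symm.trans h2
  refine Prod.ext rfl ?_
  funext l i
  let et1 : B.MomFibre y' := (c.homCoord y' l i).smulRight (c.volX (B.proj y'))
  have h1' : c.momArr y' et1 = stdArr l i := by
    funext l' i'
    change TopForm.ev (c.frameX (B.proj y')) (et1 (c.elemHom y' l' i')) = _
    simp only [et1, ContinuousLinearMap.smulRight_apply, map_smul, hv, hce, smul_eq_mul, mul_one]
    by_cases h1 : l = l'
    · subst h1
      by_cases h2 : i = i'
      · subst h2; simp [stdArr]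
      · have : ¬ i' = i := fun h => h2 h.symm
        simp [stdArr, h2, this]
    · have : ¬ l' = l := fun h => h1 h.symm
      simp [stdArr, h1, this]
  have h5 := congrArg (TopForm.ev (c.frameX (B.proj y'))) (DFunLike.congr_fun h4 et1)
  simp only [ContinuousLinearMap.smulRight_apply, map_smul, hv, smul_eq_mul, mul_one,
    zero_apply, map_zero, sub_apply, sum_apply, smul_apply,
    ContinuousLinearMap.comp_apply, ContinuousLinearMap.proj_apply, h1',
    ContinuousLinearMap.prod_apply] at h5
  have h6 : ∑ l', ∑ i', (c.jetChart z).2 l' i' * stdArr l i l' i' = (c.jetChart z).2 l i := by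
    rw [Finset.sum_eq_single l, Finset.sum_eq_single i]
    · simp [stdArr]
    · intro b _ hb; simp [stdArr, hb]
    · simp
    · intro b _ hb; simp [stdArr, hb]
    · simp
  rw [h6] at h5
  exact sub_eq_zero.1 h5

end Coord

end Polysymplectic

end

/-!
The Hamilton and Cartan equations are compared through a single identity: for an almost-regular
Lagrangian and an associated Hamiltonian, at every point of `J¹Y`,
`𝓛 = π^λ_i y^i_λ - ℋ(x^λ, y^i, π^λ_i)`, `π^λ_i = ∂^λ_i 𝓛`
(`Lagrangian.pull_legendre`, and `Lagrangian.expr_eq` in coordinates).  For `ℋ` associated to `L`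
it is assumed only at the points of the image of `N_L` under `Ĥ`.  On the fibre of the Legendre map
`L̂` over `p`, however, the function `𝓛 - p^λ_i y^i_λ` has zero derivative; the fibre is a connected
fibre of a submersion, so by the implicit function theorem (`eq_of_fderiv_eq_zero_on_fiber`) this
function is constant on it.  As `L̂ ∘ Ĥ` is the identity on `N_L`, every such fibre contains a point
of `Ĥ(N_L)`, and the identity holds on all of `J¹Y`.

Differentiation along `∂_i` gives `∂_i 𝓛 + (∂^j_λ ℋ - y^j_λ) ∂_i π^λ_j = -∂_i ℋ`, with `ℋ` taken at
the image of `L̂` (`Lagrangian.partialY_expr_add`).  Where `ŷ^j_λ = ∂^j_λ ℋ`, which is the first half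
of the Hamilton equations for `r`, and in the converse direction the assumption
`Ĥ ∘ L̂ ∘ σ = J¹(π¹₀ ∘ σ)`, this identity turns the second Cartan equation into the second half of
the Hamilton equations, and vice versa, since `π^λ_i` along the section of `J¹Y` is `p^λ_i` along the
section of `Π`.  For `σ = Ĥ ∘ r` moreover `ŷ = y`, so that the first Cartan equation is trivial and
the second one is the Euler-Lagrange equation.
-/

namespace Polysymplectic

/-! ### Functions on the fibres of a submersion -/

/-- A function `u` whose derivative vanishes at the points of the fibre of `f` through `a` is
constant on that fibre near `a`, if `f` is a submersion at `a`.  The implicit function theorem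
parametrizes the fibre by a ball in the kernel of the derivative of `f` at `a`, and `u` has zero
derivative along this parametrization. -/
theorem eventually_eq_of_fderiv_eq_zero_on_fiber {E K : Type*} [NormedAddCommGroup E]
    [NormedSpace ℝ E] [FiniteDimensional ℝ E] [NormedAddCommGroup K] [NormedSpace ℝ K]
    [FiniteDimensional ℝ K] {f : E → K} {a : E} (hf : ContDiffAt ℝ 1 f a)
    (hsurj : Function.Surjective (fderiv ℝ f a)) {u : E → ℝ} (hu : Differentiable ℝ u)
    (hzero : ∀ᶠ v in 𝓝 a, f v = f a → fderiv ℝ u v = 0) :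
    ∀ᶠ v in 𝓝 a, f v = f a → u v = u a := by
  have := FiniteDimensional.complete ℝ E
  have := FiniteDimensional.complete ℝ K
  let D := HasStrictFDerivAt.implicitFunctionDataOfComplemented f (fderiv ℝ f a)
    (hf.hasStrictFDerivAt one_ne_zero) (LinearMap.range_eq_top.2 hsurj)
    (fderiv ℝ f a).ker_closedComplemented_of_finiteDimensional_range
  -- `e v = (f v, pr (v - a))`, with `pr` a projection onto the kernel, straightens the fibres.
  let e := D.toOpenPartialHomeomorph
  have hpt : e a = (f a, 0) := by
    refine Prod.ext rfl ?_
    change Classical.choose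
      (fderiv ℝ f a).ker_closedComplemented_of_finiteDimensional_range (a - a) = 0
    rw [sub_self, map_zero]
  have ha : a ∈ e.source := D.pt_mem_toOpenPartialHomeomorph_source
  have he : ContDiffAt ℝ 1 e.symm (f a, 0) := by
    have h := D.contDiffAt_implicitFunction (n := 1) hf
      ((Classical.choose (fderiv ℝ f a).ker_closedComplemented_of_finiteDimensional_range).contDiff
        |>.contDiffAt.comp a (contDiffAt_id.sub contDiffAt_const)) one_ne_zero
    have h2 : D.prodFun D.pt = (f a, 0) := hpt
    rw [h2] at h
    exact h
  have hs0 : e.symm (f a, 0) = a := by rw [← hpt]; exact e.left_inv ha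
  have hcont : Filter.Tendsto (fun t : (fderiv ℝ f a).ker => (f a, t)) (𝓝 0) (𝓝 (f a, 0)) :=
    (Continuous.prodMk_right (f a)).tendsto 0
  have hlim : Filter.Tendsto (fun t : (fderiv ℝ f a).ker => e.symm (f a, t)) (𝓝 0) (𝓝 a) := by
    have h := he.continuousAt.tendsto.comp hcont
    rwa [hs0] at h
  have hev : ∀ᶠ t : (fderiv ℝ f a).ker in 𝓝 0, ContDiffAt ℝ 1 e.symm (f a, t) ∧
      f (e.symm (f a, t)) = f a ∧ fderiv ℝ u (e.symm (f a, t)) = 0 := by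
    have htgt : (f a, 0) ∈ e.target := hpt ▸ e.map_source ha
    filter_upwards [hcont.eventually (he.eventually (by simp)),
      hcont.eventually (e.open_target.mem_nhds htgt), hlim.eventually hzero] with t h1 h2 h3
    have h4 : f (e.symm (f a, t)) = f a := congrArg Prod.fst (e.right_inv h2)
    exact ⟨h1, h4, h3 h4⟩
  obtain ⟨r, hr, hball⟩ := Metric.eventually_nhds_iff_ball.1 hev
  have hderiv : ∀ t ∈ Metric.ball (0 : (fderiv ℝ f a).ker) r,
      HasFDerivAt (fun t => u (e.symm (f a, t))) (0 : (fderiv ℝ f a).ker →L[ℝ] ℝ) t := by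
    intro t ht
    obtain ⟨h1, -, h3⟩ := hball t ht
    have h4 : DifferentiableAt ℝ (fun t : (fderiv ℝ f a).ker => e.symm (f a, t)) t :=
      (h1.differentiableAt one_ne_zero).comp t
        ((differentiableAt_const _).prodMk differentiableAt_id)
    have h5 := (hu (e.symm (f a, t))).hasFDerivAt.comp t h4.hasFDerivAt
    rw [h3, ContinuousLinearMap.zero_comp] at h5
    exact h5
  have hconst : ∀ t ∈ Metric.ball (0 : (fderiv ℝ f a).ker) r, u (e.symm (f a, t)) = u a := by
    intro t ht
    have h := Metric.isOpen_ball.is_const_of_fderiv_eq_zero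
      (convex_ball (0 : (fderiv ℝ f a).ker) r).isPreconnected
      (fun s hs => (hderiv s hs).differentiableAt.differentiableWithinAt)
      (fun s hs => (hderiv s hs).fderiv) ht (Metric.mem_ball_self hr)
    simpa only [hs0] using h
  have hsnd : Filter.Tendsto (fun v => (e v).2) (𝓝 a) (𝓝 0) := by
    have h := (e.continuousAt ha).tendsto
    rw [hpt] at h
    exact (continuous_snd.tendsto _).comp h
  filter_upwards [e.open_source.mem_nhds ha,
    hsnd.eventually (Metric.ball_mem_nhds _ hr)] with v hv hvr hfv
  have h1 : e v = (f a, (e v).2) := Prod.ext hfv rfl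
  have h2 := hconst _ hvr
  rw [← h1, e.left_inv hv] at h2
  exact h2

/-- A function `u` whose derivative vanishes at the points of a connected fibre of a submersion `g`
is constant on that fibre.  Regularity of the fibre matters: on an arbitrary connected set of
critical points a differentiable function need not be constant. -/
theorem eq_of_fderiv_eq_zero_on_fiber {E : Type*} [NormedAddCommGroup E]
    [NormedSpace ℝ E] [FiniteDimensional ℝ E] {k : ℕ} {Q : Type*} [TopologicalSpace Q]
    [ChartedSpace (Eu k) Q] [IsManifold 𝓘(ℝ, Eu k) ∞ Q] {g : E → Q} {b : Q}
    (hg : ContMDiff 𝓘(ℝ, E) 𝓘(ℝ, Eu k) ∞ g)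
    (hsurj : ∀ v, Function.Surjective (mfderiv 𝓘(ℝ, E) 𝓘(ℝ, Eu k) g v))
    (hconn : IsPreconnected {v | g v = b}) {u : E → ℝ} (hu : Differentiable ℝ u)
    (hzero : ∀ v, g v = b → fderiv ℝ u v = 0) {v w : E} (hv : g v = b) (hw : g w = b) :
    u v = u w := by
  refine hconn.induction₂ (fun v w => u v = u w) (fun v hv => ?_)
    (fun _ _ _ _ _ _ => Eq.trans) (fun _ _ _ _ => Eq.symm) hv hw
  let f : E → Eu k := fun w => chartAt (Eu k) (g v) (g w)
  have hcd : ContDiffAt ℝ 1 f v := by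
    have h1 : ContMDiffAt 𝓘(ℝ, Eu k) 𝓘(ℝ, Eu k) ∞ (chartAt (Eu k) (g v)) (g v) :=
      contMDiffAt_of_mem_maximalAtlas (IsManifold.chart_mem_maximalAtlas _)
        (mem_chart_source _ _)
    have h2 := h1.comp v (hg v)
    exact (contMDiffAt_iff_contDiffAt.1 h2).of_le (by simp)
  have hfs : Function.Surjective (fderiv ℝ f v) := by
    have h1 : (mfderiv 𝓘(ℝ, E) 𝓘(ℝ, Eu k) g v : E →L[ℝ] Eu k) = fderiv ℝ f v := by
      rw [((hg v).mdifferentiableAt (by simp)).mfderiv]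
      simp [writtenInExtChartAt, Function.comp_def, f]
      rfl
    rw [← h1]
    exact hsurj v
  have h := eventually_eq_of_fderiv_eq_zero_on_fiber hcd hfs hu ?_
  · filter_upwards [h.filter_mono nhdsWithin_le_nhds, self_mem_nhdsWithin] with w hw hwb
    have : g w = g v := (show g w = b from hwb).trans (show g v = b from hv).symm
    exact (hw (congrArg (chartAt (Eu k) (g v)) this)).symm
  · have hsrc : ∀ᶠ w in 𝓝 v, g w ∈ (chartAt (Eu k) (g v)).source :=
      (hg v).continuousAt.eventually_mem ((chartAt (Eu k) (g v)).open_source.mem_nhds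
        (mem_chart_source _ _))
    filter_upwards [hsrc] with w hw hfw
    exact hzero w (((chartAt (Eu k) (g v)).injOn hw (mem_chart_source _ _) hfw).trans hv)

variable {n m : ℕ} {X Y F : Type*}
  [TopologicalSpace X] [ChartedSpace (Eu n) X]
  [TopologicalSpace Y] [ChartedSpace (TotMod n m) Y]
  [TopologicalSpace F] [ChartedSpace (Eu m) F]

/-! ### Coordinate expressions -/

theorem sum_stdArr (A : Arr n m) : ∑ l, ∑ i, A l i • stdArr l i = A := by
  funext k h
  simp only [Finset.sum_apply, Pi.smul_apply, smul_eq_mul]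
  rw [Finset.sum_eq_single k, Finset.sum_eq_single h]
  · simp [stdArr]
  · intro b _ hb; simp [stdArr, hb.symm]
  · simp
  · intro b _ hb; simp [stdArr, hb.symm]
  · simp

theorem fderiv_snd_eq_sum_partialA (f : TotMod n m × Arr n m → ℝ) (w : TotMod n m × Arr n m)
    (A : Arr n m) : fderiv ℝ f w (0, A) = ∑ l, ∑ i, A l i * partialA l i f w := by
  have h : ((0 : TotMod n m), A) = ∑ l, ∑ i, A l i • ((0 : TotMod n m), stdArr l i) := by
    refine Prod.ext ?_ ?_
    · simp [Prod.fst_sum]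
    · simp only [Prod.snd_sum, Prod.smul_snd]
      exact (sum_stdArr A).symm
  rw [h]
  simp only [map_sum, map_smul, smul_eq_mul, partialA]

/-- The fibre derivative `(a, v) ↦ (a, ∂f/∂v)` of a function of `(x^λ, y^i, y^i_λ)` or of
`(x^λ, y^i, p^λ_i)`.  Applied to `𝓛` and to `ℋ` it gives the coordinate expressions of the Legendre
map and of the Hamiltonian map. -/
noncomputable def fibreDeriv (f : TotMod n m × Arr n m → ℝ) (w : TotMod n m × Arr n m) :
    TotMod n m × Arr n m :=
  (w.1, fun l i => partialA l i f w)

theorem contDiffAt_partialA {f : TotMod n m × Arr n m → ℝ} {w : TotMod n m × Arr n m}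
    (hf : ContDiffAt ℝ ∞ f w) (l : Fin n) (i : Fin m) : ContDiffAt ℝ ∞ (partialA l i f) w :=
  (hf.fderiv_right (by simp)).clm_apply contDiffAt_const

theorem contDiffAt_fibreDeriv {f : TotMod n m × Arr n m → ℝ} {w : TotMod n m × Arr n m}
    (hf : ContDiffAt ℝ ∞ f w) : ContDiffAt ℝ ∞ (fibreDeriv f) w :=
  contDiffAt_fst.prodMk <| contDiffAt_pi.2 fun l => contDiffAt_pi.2 fun i =>
    contDiffAt_partialA hf l i

variable {B : FibBundle n m X Y F} (c : FibChart B)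

theorem FibChart.isOpen_jetTarget :
    IsOpen (c.total.target ×ˢ (univ : Set (Arr n m))) :=
  c.total.open_target.prod isOpen_univ

theorem Lagrangian.contDiffAt_expr (L : Lagrangian B) {w : TotMod n m × Arr n m}
    (hw : w.1 ∈ c.total.target) : ContDiffAt ℝ ∞ (L.expr c) w :=
  (L.smooth c).contDiffAt (c.isOpen_jetTarget.mem_nhds ⟨hw, mem_univ _⟩)

theorem Hamiltonian.contDiffAt_expr (H : Hamiltonian B) {w : TotMod n m × Arr n m}
    (hw : w.1 ∈ c.total.target) : ContDiffAt ℝ ∞ (H.expr c) w :=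
  (H.smooth c).contDiffAt (c.isOpen_jetTarget.mem_nhds ⟨hw, mem_univ _⟩)

theorem Hamiltonian.map_point (H : Hamiltonian B) (q : Momentum B) :
    (H.map q).point = q.point :=
  (H.exists_isMapValue q).choose_spec.1

theorem FibChart.jetChart_symm_point {w : TotMod n m × Arr n m} (hw : w.1 ∈ c.total.target) :
    (c.jetChart.symm w).point = c.total.symm w.1 := by
  rw [c.jetChart_symm w hw]

theorem Lagrangian.momentumChart_legendre_eq_fibreDeriv (L : Lagrangian B) {z : Jet B}
    (hz : z.point ∈ c.total.source) :
    c.momentumChart (L.legendre z) = fibreDeriv (L.expr c) (c.jetChart z) :=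
  L.momentumChart_legendre c hz

theorem Hamiltonian.jetChart_map_eq_fibreDeriv (H : Hamiltonian B) {q : Momentum B}
    (hq : q.point ∈ c.total.source) :
    c.jetChart (H.map q) = fibreDeriv (H.expr c) (c.momentumChart q) :=
  H.jetChart_map c hq

/-! ### The Lagrangian as the pull-back of the Hamiltonian -/

/-- The function `𝓛 - p^λ_i y^i_λ` is constant on the fibre of the Legendre map over the point
`p^λ_i`.  Its derivative `∂^λ_i 𝓛 - p^λ_i` vanishes there, and the fibre is connected and is also a
fibre of a submersion.  The coordinates are those over which the definition of almost-regularity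
trivializes `N_L`. -/
theorem Lagrangian.sub_eq_on_fibre (L : Lagrangian B) (hL : L.IsAlmostRegular) (y : Y) :
    ∃ c : FibChart B, y ∈ c.total.source ∧ ∀ z z' : Jet B, z.point = y → z'.point = y →
      L.legendre z = L.legendre z' →
      L.expr c (c.jetChart z) -
          ∑ l, ∑ i, (c.momentumChart (L.legendre z)).2 l i * (c.jetChart z).2 l i =
        L.expr c (c.jetChart z') -
          ∑ l, ∑ i, (c.momentumChart (L.legendre z)).2 l i * (c.jetChart z').2 l i := by
  obtain ⟨c, hy, k, Q, _, _, _, T, g, hTg, hg, hgsurj⟩ := hL.fibred y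
  refine ⟨c, hy, fun z z' hz hz' hzz => ?_⟩
  subst hz
  set a := c.total z.point with ha
  have hat : a ∈ c.total.target := c.total.map_source hy
  set p := (c.momentumChart (L.legendre z)).2 with hp
  have hTinj : ∀ f f' : Q, T.toFun (a, f) = T.toFun (a, f') → f = f' := by
    intro f f' h
    have := T.embedding.injective (a₁ := ((⟨a, hat⟩ : c.total.target), f))
      (a₂ := (⟨a, hat⟩, f')) (Prod.ext rfl h)
    exact congrArg Prod.snd this
  have hsymm : ∀ v : Arr n m, (c.jetChart.symm (a, v)).point = z.point := by
    intro v
    rw [c.jetChart_symm_point (w := (a, v)) hat]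
    exact c.total.left_inv hy
  have hzc : c.jetChart z = (a, (c.jetChart z).2) := rfl
  have hzc' : c.jetChart z' = (a, (c.jetChart z').2) :=
    Prod.ext (show c.total z'.point = a by rw [hz']) rfl
  -- The trivialization of `N_L` is injective on fibres, so `g` and `L̂` have the same fibres.
  have hfib : ∀ v : Arr n m, g (a, v) = g (a, (c.jetChart z).2) ↔
      L.legendre (c.jetChart.symm (a, v)) = L.legendre z := by
    intro v
    have e1 : L.legendreExpr c (a, (c.jetChart z).2) = p := by
      rw [← hzc, Lagrangian.legendreExpr, c.jetChart.left_inv hy]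
    constructor
    · intro h
      have h2 := hTg a hat v
      rw [h, hTg a hat, e1] at h2
      refine c.momentumChart.injOn (show (c.jetChart.symm (a, v)).point ∈ c.total.source by
        rw [hsymm]; exact hy) hy (Prod.ext ?_ h2.symm)
      change c.total (c.jetChart.symm (a, v)).point = c.total z.point
      rw [hsymm]
    · intro h
      refine hTinj _ _ ?_
      rw [hTg a hat, hTg a hat, e1, Lagrangian.legendreExpr, h]
  have hexpr : ∀ v, DifferentiableAt ℝ (L.expr c) (a, v) := fun v =>
    (L.contDiffAt_expr c (w := (a, v)) hat).differentiableAt (by simp)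
  let P : Arr n m →L[ℝ] ℝ := ∑ l, ∑ i, p l i • ((ContinuousLinearMap.proj i).comp
    (ContinuousLinearMap.proj l : Arr n m →L[ℝ] Fin m → ℝ))
  have hP : ∀ v, P v = ∑ l, ∑ i, p l i * v l i := by intro v; simp [P]
  have hderiv : ∀ v, HasFDerivAt (fun v => L.expr c (a, v) - P v)
      ((fderiv ℝ (L.expr c) (a, v)).comp (ContinuousLinearMap.inr ℝ (TotMod n m) (Arr n m)) - P)
      v := fun v =>
    ((hexpr v).hasFDerivAt.comp v (hasFDerivAt_prodMk_right a v)).sub P.hasFDerivAt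
  have hconn : IsPreconnected {v : Arr n m | g (a, v) = g (a, (c.jetChart z).2)} := by
    have h1 := (hL.connected (L.legendre z) (mem_range_self z)).isPreconnected
    have h2 := h1.image
      (fun (G : Eu n →L[ℝ] TotMod n m) (l : Fin n) (i : Fin m) =>
        (c.dTotal z.point (G (c.frameX (B.proj z.point) l))).2 i) (by fun_prop)
    have hcoord : ∀ z1 : Jet B, z1.point = z.point →
        (fun (l : Fin n) (i : Fin m) =>
          (c.dTotal z.point (z1.lin (c.frameX (B.proj z.point) l))).2 i) =
          (c.jetChart z1).2 := by
      intro z1 h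
      rw [← h]
      rfl
    convert h2 using 1
    ext v
    simp only [mem_ofPred_eq, mem_image, exists_exists_and_eq_and]
    rw [hfib]
    constructor
    · intro h
      refine ⟨_, h, ?_⟩
      rw [hcoord _ (hsymm v), c.jetChart.right_inv ⟨hat, mem_univ _⟩]
    · rintro ⟨z1, h1, rfl⟩
      have h3 : z1.point = z.point := congrArg Momentum.point h1
      have h4 : (a, (c.jetChart z1).2) = c.jetChart z1 :=
        Prod.ext (show a = c.total z1.point by rw [h3]) rfl
      rw [hcoord _ h3, h4, c.jetChart.left_inv (show z1.point ∈ c.total.source by rwa [h3])]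
      exact h1
  have key := eq_of_fderiv_eq_zero_on_fiber (g := fun v => g (a, v))
    (b := g (a, (c.jetChart z).2)) (u := fun v => L.expr c (a, v) - P v)
    ?_ (hgsurj a hat) hconn (fun v => (hderiv v).differentiableAt) ?_
    (v := (c.jetChart z).2) (w := (c.jetChart z').2) rfl ?_
  · simp only [hP] at key
    rw [hzc', hzc]
    exact key
  · intro v
    have h1 : ContMDiffAt 𝓘(ℝ, TotMod n m × Arr n m) 𝓘(ℝ, Eu k) ∞ g (a, v) :=
      hg.contMDiffAt (c.isOpen_jetTarget.mem_nhds ⟨hat, mem_univ _⟩)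
    have h2 : ContMDiffAt 𝓘(ℝ, Arr n m) 𝓘(ℝ, TotMod n m × Arr n m) ∞ (fun v : Arr n m => (a, v))
        v := (contDiffAt_const.prodMk contDiffAt_id).contMDiffAt
    exact h1.comp v h2
  · intro v hv
    rw [(hderiv v).fderiv]
    have h1 := (hfib v).1 hv
    have h2 : p = fun l i => partialA l i (L.expr c) (a, v) := by
      have h3 := L.momentumChart_legendre c (z := c.jetChart.symm (a, v))
        (by rw [hsymm]; exact hy)
      rw [h1, c.jetChart.right_inv ⟨hat, mem_univ _⟩] at h3
      exact congrArg Prod.snd h3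
    ext A
    simp only [sub_apply, ContinuousLinearMap.comp_apply, ContinuousLinearMap.inr_apply, zero_apply]
    rw [fderiv_snd_eq_sum_partialA, hP, h2, sub_eq_zero]
    simp only [mul_comm]
  · rw [hfib, ← hzc', c.jetChart.left_inv (show z'.point ∈ c.total.source by rw [hz']; exact hy)]
    exact hzz.symm

/-- `L` is the pull-back of the Hamiltonian form: `L(z) = z*H(L̂(z))` for every jet `z`.  For `z` in
the image of `Ĥ ∘ L̂` this is the second condition for `ℋ` to be associated to `L`; it extends to the
whole fibre of `L̂` through `Ĥ(L̂(z))`, which contains `z`, because both sides differ by a constant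
on that fibre. -/
theorem Lagrangian.pull_legendre (L : Lagrangian B) (hL : L.IsAlmostRegular) (H : Hamiltonian B)
    (hH : H.IsAssociated L) (z : Jet B) : z.pull (H.toFun (L.legendre z)) = L.toFun z := by
  obtain ⟨c, hz, hc⟩ := L.sub_eq_on_fibre hL z.point
  have hx := c.proj_mem _ hz
  have hq : (L.legendre z).point ∈ c.total.source := hz
  have h1 := hc z (H.map (L.legendre z)) rfl (H.map_point _) (hH.1 _ (mem_range_self z)).symm
  have h2 := hH.2 c (L.legendre z) (mem_range_self z) hz
  have h3 := H.ev_pull c hz (L.legendre z).form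
  change TopForm.ev _ (z.pull (H.toFun (L.legendre z))) =
    ∑ l, ∑ i, (c.momentumChart (L.legendre z)).2 l i * (c.jetChart z).2 l i -
      H.expr c (c.momentumChart (L.legendre z)) at h3
  rw [H.jetChart_map c hq] at h1
  rw [c.topForm_eq_volX hx (z.pull _), c.topForm_eq_volX hx (L.toFun z), h3, L.ev_toFun c hz]
  congr 1
  simp only at h1 h2
  have h4 : (c.momentumChart (L.legendre z)).1 = c.total (L.legendre z).point := rfl
  rw [h4] at h2
  linarith

/-- The coordinate form of `Lagrangian.pull_legendre`, valid in any fibred chart: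
`𝓛 = π^λ_i y^i_λ - ℋ(x^λ, y^i, π^λ_i)` with `π^λ_i = ∂^λ_i 𝓛`. -/
theorem Lagrangian.expr_eq (L : Lagrangian B) (hL : L.IsAlmostRegular) (H : Hamiltonian B)
    (hH : H.IsAssociated L) {w : TotMod n m × Arr n m} (hw : w.1 ∈ c.total.target) :
    L.expr c w = ∑ l, ∑ i, partialA l i (L.expr c) w * w.2 l i -
      H.expr c (fibreDeriv (L.expr c) w) := by
  set z := c.jetChart.symm w
  have hzw : c.jetChart z = w := c.jetChart.right_inv ⟨hw, mem_univ _⟩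
  have hz : z.point ∈ c.total.source := c.jetChart.map_target ⟨hw, mem_univ _⟩
  have h1 := L.ev_toFun c hz
  have h3 := H.ev_pull c hz (L.legendre z).form
  change TopForm.ev _ (z.pull (H.toFun (L.legendre z))) =
    ∑ l, ∑ i, (c.momentumChart (L.legendre z)).2 l i * (c.jetChart z).2 l i -
      H.expr c (c.momentumChart (L.legendre z)) at h3
  rw [L.pull_legendre hL H hH z, h1, L.momentumChart_legendre_eq_fibreDeriv c hz, hzw] at h3
  exact h3

/-- The derivative of `Lagrangian.expr_eq` in the direction of `y^i`:
`∂_i 𝓛 + (∂^h_l ℋ - y^h_l) ∂_i π^l_h = -∂_i ℋ`, where `ℋ` is taken at the image of the Legendre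
map.  The left-hand side is the Cartan expression without the total derivative of `π`, when
`ŷ = ∂ℋ/∂p`. -/
theorem Lagrangian.partialY_expr_add (L : Lagrangian B) (hL : L.IsAlmostRegular)
    (H : Hamiltonian B) (hH : H.IsAssociated L) {w : TotMod n m × Arr n m}
    (hw : w.1 ∈ c.total.target) (i : Fin m) :
    partialY i (L.expr c) w
      + ∑ l, ∑ h, (partialA l h (H.expr c) (fibreDeriv (L.expr c) w) - w.2 l h) *
          partialY i (partialA l h (L.expr c)) w =
      -partialY i (H.expr c) (fibreDeriv (L.expr c) w) := by
  set e : TotMod n m × Arr n m := ((0, stdVec i), 0) with he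
  have hLw := L.contDiffAt_expr c hw
  have hp : ∀ l h, HasFDerivAt (partialA l h (L.expr c))
      (fderiv ℝ (partialA l h (L.expr c)) w) w := fun l h =>
    ((contDiffAt_partialA hLw l h).differentiableAt (by simp)).hasFDerivAt
  have hv : ∀ l h, HasFDerivAt (fun w : TotMod n m × Arr n m => w.2 l h)
      ((ContinuousLinearMap.proj h).comp ((ContinuousLinearMap.proj l :
        Arr n m →L[ℝ] Fin m → ℝ).comp (ContinuousLinearMap.snd ℝ (TotMod n m) (Arr n m)))) w :=
    fun l h => ((ContinuousLinearMap.proj (R := ℝ) (φ := fun _ : Fin m => ℝ) h).comp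
      ((ContinuousLinearMap.proj l : Arr n m →L[ℝ] Fin m → ℝ).comp
        (ContinuousLinearMap.snd ℝ (TotMod n m) (Arr n m)))).hasFDerivAt
  have hfd : HasFDerivAt (fibreDeriv (L.expr c))
      ((ContinuousLinearMap.fst ℝ (TotMod n m) (Arr n m)).prod
        (ContinuousLinearMap.pi fun l => ContinuousLinearMap.pi fun h =>
          fderiv ℝ (partialA l h (L.expr c)) w)) w :=
    hasFDerivAt_fst.prodMk (hasFDerivAt_pi.2 fun l => hasFDerivAt_pi.2 fun h => hp l h)
  have hHw : HasFDerivAt (H.expr c) (fderiv ℝ (H.expr c) (fibreDeriv (L.expr c) w))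
      (fibreDeriv (L.expr c) w) :=
    ((H.contDiffAt_expr c (w := fibreDeriv (L.expr c) w) hw).differentiableAt
      (by simp)).hasFDerivAt
  have hR := (HasFDerivAt.fun_sum (u := Finset.univ) fun l _ =>
    HasFDerivAt.fun_sum (u := Finset.univ) fun h _ => (hp l h).mul (hv l h)).sub
      (hHw.comp w hfd)
  have hev : L.expr c =ᶠ[𝓝 w] fun w => ∑ l, ∑ i, partialA l i (L.expr c) w * w.2 l i -
      H.expr c (fibreDeriv (L.expr c) w) := by
    filter_upwards [c.isOpen_jetTarget.mem_nhds ⟨hw, mem_univ _⟩] with w' hw'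
    exact L.expr_eq c hL H hH hw'.1
  have hd := DFunLike.congr_fun (hR.congr_of_eventuallyEq hev).fderiv e
  -- The derivative of `w ↦ (w.1, π(w))` along `∂_i` splits into `∂_i` and a momentum component.
  have hsplit : ((e.1, fun l h => fderiv ℝ (partialA l h (L.expr c)) w e) :
      TotMod n m × Arr n m) = e + (0, fun l h => fderiv ℝ (partialA l h (L.expr c)) w e) := by
    simp [he]
  have hsnd : ∀ l h, e.2 l h = 0 := fun _ _ => rfl
  simp only [sub_apply, sum_apply, add_apply, smul_apply, smul_eq_mul,
    ContinuousLinearMap.comp_apply, ContinuousLinearMap.prod_apply,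
    ContinuousLinearMap.coe_snd', ContinuousLinearMap.coe_fst', ContinuousLinearMap.proj_apply,
    hsnd, mul_zero, zero_add] at hd
  have hpi : (ContinuousLinearMap.pi fun l => ContinuousLinearMap.pi fun h =>
      fderiv ℝ (partialA l h (L.expr c)) w) e =
      fun l h => fderiv ℝ (partialA l h (L.expr c)) w e := rfl
  rw [hpi, hsplit, map_add, fderiv_snd_eq_sum_partialA] at hd
  simp only [partialY, ← he]
  rw [hd]
  simp only [sub_mul, Finset.sum_sub_distrib, mul_comm]
  ring

/-! ### Sections and their prolongations -/

namespace FibBundle.IsSection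

variable {U : Set X} {s : X → Y} {c}

theorem base_mem (hs : B.IsSection U s) {x : X} (hx : x ∈ U) (hc : s x ∈ c.total.source) :
    x ∈ c.base.source := by
  have h := c.proj_mem _ hc
  rwa [hs.1 x hx] at h

theorem eventually_mem (hs : B.IsSection U s) (hU : IsOpen U) {x : X} (hx : x ∈ U)
    (hc : s x ∈ c.total.source) : ∀ᶠ x' in 𝓝 x, x' ∈ U ∧ s x' ∈ c.total.source :=
  (hU.eventually_mem hx).and
    ((hs.2.contMDiffAt (hU.mem_nhds hx)).continuousAt.eventually_mem
      (c.total.open_source.mem_nhds hc))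

theorem eventually_symm_mem (hs : B.IsSection U s) (hU : IsOpen U) {x : X} (hx : x ∈ U)
    (hc : s x ∈ c.total.source) :
    ∀ᶠ t in 𝓝 (c.base x), c.base.symm t ∈ U ∧ s (c.base.symm t) ∈ c.total.source :=
  (c.base.tendsto_symm (hs.base_mem hx hc)).eventually (hs.eventually_mem hU hx hc)

theorem dproj_comp_mfderiv (hs : B.IsSection U s) (hU : IsOpen U) {x : X} (hx : x ∈ U) :
    (B.dproj (s x)).comp
      (mfderiv 𝓘(ℝ, Eu n) 𝓘(ℝ, TotMod n m) s x : Eu n →L[ℝ] TotMod n m) =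
      ContinuousLinearMap.id ℝ (Eu n) := by
  have h1 : MDifferentiableAt 𝓘(ℝ, Eu n) 𝓘(ℝ, TotMod n m) s x :=
    (hs.2.contMDiffAt (hU.mem_nhds hx)).mdifferentiableAt (by simp)
  have h2 : MDifferentiableAt 𝓘(ℝ, TotMod n m) 𝓘(ℝ, Eu n) B.proj (s x) :=
    B.smooth.mdifferentiableAt (by simp)
  have h3 := h2.hasMFDerivAt.comp x h1.hasMFDerivAt
  have h4 : (B.proj ∘ s) =ᶠ[𝓝 x] id := by
    filter_upwards [hU.mem_nhds hx] with x' hx' using hs.1 x' hx'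
  exact hasMFDerivAt_unique (h3.congr_of_eventuallyEq h4.symm) (hasMFDerivAt_id x)

/-- In coordinates, `y^i_λ ∘ J¹s = ∂(y^i ∘ s)/∂x^λ`. -/
theorem jetChart_prolong (hs : B.IsSection U s) (hU : IsOpen U) {x : X} (hx : x ∈ U)
    (hc : s x ∈ c.total.source) :
    c.jetChart (B.prolong s x) = (c.total (s x), fun l i =>
      partialX l (fun t => (c.total (s (c.base.symm t))).2 i) (c.base x)) := by
  have hb := hs.base_mem hx hc
  rw [FibBundle.prolong, dif_pos (hs.dproj_comp_mfderiv hU hx)]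
  refine Prod.ext rfl ?_
  funext l i
  change (c.dTotal (s x) ((mfderiv 𝓘(ℝ, Eu n) 𝓘(ℝ, TotMod n m) s x : Eu n →L[ℝ] TotMod n m)
    (c.frameX (B.proj (s x)) l))).2 i = _
  rw [hs.1 x hx]
  have h1 : MDifferentiableAt 𝓘(ℝ, Eu n) 𝓘(ℝ, Eu n) c.base.symm (c.base x) :=
    ((contMDiffOn_symm_of_mem_maximalAtlas c.base_mem).contMDiffAt
      (c.base.open_target.mem_nhds (c.base.map_source hb))).mdifferentiableAt (by simp)
  have hl : c.base.symm (c.base x) = x := c.base.left_inv hb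
  have h2 : MDifferentiableAt 𝓘(ℝ, Eu n) 𝓘(ℝ, TotMod n m) s (c.base.symm (c.base x)) := by
    rw [hl]; exact (hs.2.contMDiffAt (hU.mem_nhds hx)).mdifferentiableAt (by simp)
  have h3 : MDifferentiableAt 𝓘(ℝ, TotMod n m) 𝓘(ℝ, TotMod n m) c.total
      (s (c.base.symm (c.base x))) := by
    rw [hl]; exact c.mdiff_total.mdifferentiableAt hc
  have h4 := ((h3.hasMFDerivAt.comp (c.base.symm (c.base x)) h2.hasMFDerivAt).comp (c.base x)
    h1.hasMFDerivAt).hasFDerivAt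
  have h5 := ((EuclideanSpace.proj i : Eu m →L[ℝ] ℝ).comp
    (ContinuousLinearMap.snd ℝ (Eu n) (Eu m))).hasFDerivAt.comp (c.base x) h4
  have h6 : partialX l (fun t => (c.total (s (c.base.symm t))).2 i) (c.base x) = _ :=
    DFunLike.congr_fun h5.fderiv (stdVec l)
  refine Eq.trans ?_ h6.symm
  rw [hl]
  rfl

end FibBundle.IsSection

/-! ### Legendre and Hamiltonian maps along sections -/

theorem Lagrangian.isMomentumSection_legendre (L : Lagrangian B) {U : Set X} (hU : IsOpen U)
    {sg : X → Jet B} (hsg : B.IsJetSection U sg) :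
    B.IsMomentumSection U fun x => L.legendre (sg x) := by
  refine ⟨hsg.1, fun c x hx hc => ?_⟩
  have h1 : ContMDiffAt 𝓘(ℝ, TotMod n m × Arr n m) 𝓘(ℝ, TotMod n m × Arr n m) ∞
      (fibreDeriv (L.expr c)) (c.jetChart (sg x)) :=
    (contDiffAt_fibreDeriv (L.contDiffAt_expr c (c.total.map_source hc))).contMDiffAt
  refine (h1.comp x (hsg.2 c x hx hc)).congr_of_eventuallyEq ?_
  filter_upwards [hsg.1.eventually_mem hU hx hc] with x' hx'
  exact L.momentumChart_legendre_eq_fibreDeriv c hx'.2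

theorem Hamiltonian.isJetSection_map (H : Hamiltonian B) {U : Set X} (hU : IsOpen U)
    {r : X → Momentum B} (hr : B.IsMomentumSection U r) :
    B.IsJetSection U fun x => H.map (r x) := by
  have hpt : (fun x => (H.map (r x)).point) = fun x => (r x).point :=
    funext fun x => H.map_point (r x)
  refine ⟨by rw [hpt]; exact hr.1, fun c x hx hc => ?_⟩
  rw [H.map_point] at hc
  have h1 : ContMDiffAt 𝓘(ℝ, TotMod n m × Arr n m) 𝓘(ℝ, TotMod n m × Arr n m) ∞
      (fibreDeriv (H.expr c)) (c.momentumChart (r x)) :=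
    (contDiffAt_fibreDeriv (H.contDiffAt_expr c (c.total.map_source hc))).contMDiffAt
  refine (h1.comp x (hr.2 c x hx hc)).congr_of_eventuallyEq ?_
  filter_upwards [hr.1.eventually_mem hU hx hc] with x' hx'
  exact H.jetChart_map_eq_fibreDeriv c hx'.2

theorem partialX_congr {f g : Eu n → ℝ} {t : Eu n} (h : f =ᶠ[𝓝 t] g) (l : Fin n) :
    partialX l f t = partialX l g t := by
  rw [partialX, partialX, h.fderiv_eq]

/-- On holonomic sections `σ = J¹s` the Cartan equations imply the Euler-Lagrange equations. -/
theorem Lagrangian.SolvesCartan.solvesEulerLagrange {L : Lagrangian B} {U : Set X}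
    (hU : IsOpen U) {sg : X → Jet B} (hsg : L.SolvesCartan U sg)
    (hint : ∀ x ∈ U, sg x = B.prolong (fun x' => (sg x').point) x) :
    L.SolvesEulerLagrange U fun x => (sg x).point := by
  refine ⟨hsg.1.1, fun c x hx hc i => ?_⟩
  have hb := hsg.1.1.base_mem hx hc
  have hev : (fun t => c.jetChart (B.prolong (fun x' => (sg x').point) (c.base.symm t)))
      =ᶠ[𝓝 (c.base x)] fun t => c.jetChart (sg (c.base.symm t)) := by
    filter_upwards [hsg.1.1.eventually_symm_mem hU hx hc] with t ht
    rw [← hint _ ht.1]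
  have h1 := (hsg.2 c x hx hc).2 i
  have h2 : ∀ l h, partialX l (fun t => (c.jetChart (sg (c.base.symm t))).1.2 h) (c.base x) -
      (c.jetChart (sg (c.base.symm (c.base x)))).2 l h = 0 := by
    intro l h
    rw [c.base.left_inv hb, hint x hx, hsg.1.1.jetChart_prolong hU hx hc]
    exact sub_self _
  simp only [h2, zero_mul, Finset.sum_const_zero, add_zero] at h1
  simp only
  rw [hev.eq_of_nhds]
  rw [← h1]
  congr 1
  refine Finset.sum_congr rfl fun l _ => partialX_congr ?_ l
  filter_upwards [hev] with t ht
  rw [ht]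

/-- The first half of the Hamilton equations says that `Ĥ ∘ r` is holonomic. -/
theorem Hamiltonian.SolvesHamilton.map_eq_prolong {H : Hamiltonian B} {U : Set X}
    (hU : IsOpen U) {r : X → Momentum B} (hr : H.SolvesHamilton U r) {x : X} (hx : x ∈ U)
    (hc : (r x).point ∈ c.total.source) :
    H.map (r x) = B.prolong (fun x' => (r x').point) x := by
  have hb := hr.1.1.base_mem hx hc
  have hj := hr.1.1.jetChart_prolong hU hx hc
  have hpp : (B.prolong (fun x' => (r x').point) x).point = (r x).point := by
    rw [FibBundle.prolong, dif_pos (hr.1.1.dproj_comp_mfderiv hU hx)]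
  refine c.jetChart.injOn (show (H.map (r x)).point ∈ _ by rw [H.map_point]; exact hc)
    (show (B.prolong (fun x' => (r x').point) x).point ∈ _ by rw [hpp]; exact hc) ?_
  rw [hj, H.jetChart_map c hc]
  refine Prod.ext rfl ?_
  funext l i
  have h := (hr.2 c x hx hc).1 l i
  simp only [c.base.left_inv hb] at h
  exact h.symm

/-! ### Hamilton equations and Cartan equations -/

theorem Hamiltonian.SolvesHamilton.solvesCartan_map {L : Lagrangian B} (hL : L.IsAlmostRegular)
    {H : Hamiltonian B} (hH : H.IsAssociated L) {U : Set X} (hU : IsOpen U)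
    {r : X → Momentum B} (hr : H.SolvesHamilton U r) (hN : ∀ x ∈ U, r x ∈ L.constraintSpace)
    (hprol : ∀ x ∈ U, H.map (r x) = B.prolong (fun x' => (r x').point) x) :
    L.SolvesCartan U fun x => H.map (r x) := by
  refine ⟨H.isJetSection_map hU hr.1, fun c x hx hc => ?_⟩
  have hc' : (r x).point ∈ c.total.source := by rwa [H.map_point] at hc
  have hb := hr.1.1.base_mem hx hc'
  -- The section `Ĥ ∘ r` is holonomic: `ŷ = y`.
  have h2 : ∀ l h, partialX l (fun t => (c.jetChart (H.map (r (c.base.symm t)))).1.2 h)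
      (c.base x) - (c.jetChart (H.map (r (c.base.symm (c.base x))))).2 l h = 0 := by
    intro l h
    rw [c.base.left_inv hb, hprol x hx, hr.1.1.jetChart_prolong hU hx hc']
    have : ∀ t, (c.jetChart (H.map (r (c.base.symm t)))).1 =
        c.total (r (c.base.symm t)).point := fun t => congrArg c.total (H.map_point _)
    simp only [this, sub_self]
  simp only [h2, mul_zero, zero_mul, Finset.sum_const_zero, implies_true, add_zero, true_and]
  intro i
  -- Since `L̂ ∘ Ĥ` is the identity on `N_L`, the functions `π` along `Ĥ ∘ r` are the momenta of `r`.
  have hmom : c.momentumChart (r x) = fibreDeriv (L.expr c) (c.jetChart (H.map (r x))) := by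
    rw [← L.momentumChart_legendre_eq_fibreDeriv c hc, hH.1 _ (hN x hx)]
  have h3 := L.partialY_expr_add c hL H hH (w := c.jetChart (H.map (r x)))
    (c.total.map_source hc) i
  have h4 : ∀ l h, partialA l h (H.expr c) (c.momentumChart (r x)) -
      (c.jetChart (H.map (r x))).2 l h = 0 := by
    intro l h
    rw [H.jetChart_map c hc', sub_self]
  rw [← hmom] at h3
  simp only [h4, zero_mul, Finset.sum_const_zero, add_zero] at h3
  have h5 := (hr.2 c x hx hc').2 i
  simp only [c.base.left_inv hb] at h5 ⊢
  rw [h3, ← h5, sub_eq_zero]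
  refine Finset.sum_congr rfl fun l _ => partialX_congr ?_ l
  filter_upwards [hr.1.1.eventually_symm_mem hU hx hc'] with t ht
  have h6 := L.momentumChart_legendre c (z := H.map (r (c.base.symm t)))
    (by rw [H.map_point]; exact ht.2)
  rw [hH.1 _ (hN _ ht.1)] at h6
  rw [h6]

theorem Lagrangian.SolvesCartan.solvesHamilton_legendre {L : Lagrangian B}
    (hL : L.IsAlmostRegular) {H : Hamiltonian B} (hH : H.IsAssociated L) {U : Set X}
    (hU : IsOpen U) {sg : X → Jet B} (hsg : L.SolvesCartan U sg)
    (hint : ∀ x ∈ U, H.map (L.legendre (sg x)) = B.prolong (fun x' => (sg x').point) x) :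
    H.SolvesHamilton U fun x => L.legendre (sg x) := by
  refine ⟨L.isMomentumSection_legendre hU hsg.1, fun c x hx hc => ?_⟩
  replace hc : (sg x).point ∈ c.total.source := hc
  have hb := hsg.1.1.base_mem hx hc
  -- The hypothesis `Ĥ ∘ L̂ ∘ σ = J¹s` in coordinates: `ŷ = ∂ℋ/∂p`.
  have hy : ∀ l i,
      partialX l (fun t => (c.total (sg (c.base.symm t)).point).2 i) (c.base x) =
      partialA l i (H.expr c) (c.momentumChart (L.legendre (sg x))) := by
    intro l i
    have h1 := hsg.1.1.jetChart_prolong hU hx hc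
    rw [← hint x hx, H.jetChart_map c (q := L.legendre (sg x)) hc] at h1
    exact (congrFun (congrFun (congrArg Prod.snd h1) l) i).symm
  simp only [c.base.left_inv hb]
  refine ⟨hy, fun i => ?_⟩
  have h1 := L.partialY_expr_add c hL H hH (w := c.jetChart (sg x)) (c.total.map_source hc) i
  rw [← L.momentumChart_legendre_eq_fibreDeriv c hc] at h1
  simp only [← hy] at h1
  have h2 := (hsg.2 c x hx hc).2 i
  simp only [c.base.left_inv hb] at h2
  have h3 : ∀ l, partialX l
      (fun t => (c.momentumChart (L.legendre (sg (c.base.symm t)))).2 l i) (c.base x) =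
      partialX l (fun t => partialA l i (L.expr c) (c.jetChart (sg (c.base.symm t))))
        (c.base x) := by
    intro l
    refine partialX_congr ?_ l
    filter_upwards [hsg.1.1.eventually_symm_mem hU hx hc] with t ht
    rw [L.momentumChart_legendre c ht.2]
  rw [← h1, Finset.sum_congr rfl fun l _ => h3 l]
  change _ - _ + ∑ l, ∑ h, (partialX l (fun t => (c.total (sg (c.base.symm t)).point).2 h)
    (c.base x) - _) * _ = 0 at h2
  linarith

end Polysymplectic

theorem theorem3p23 {n m : ℕ} {X Y F : Type*}
    [TopologicalSpace X] [ChartedSpace (Polysymplectic.Eu n) X]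
    [IsManifold 𝓘(ℝ, Polysymplectic.Eu n) ∞ X]
    [TopologicalSpace Y] [ChartedSpace (Polysymplectic.TotMod n m) Y]
    [IsManifold 𝓘(ℝ, Polysymplectic.TotMod n m) ∞ Y]
    [TopologicalSpace F] [ChartedSpace (Polysymplectic.Eu m) F]
    [IsManifold 𝓘(ℝ, Polysymplectic.Eu m) ∞ F]
    (B : Polysymplectic.FibBundle n m X Y F)
    (L : Polysymplectic.Lagrangian B) (hL : L.IsAlmostRegular)
    (H : Polysymplectic.Hamiltonian B) (hH : H.IsAssociated L)
    (U : Set X) (hU : IsOpen U) :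
    (∀ r : X → Polysymplectic.Momentum B,
      H.SolvesHamilton U r → (∀ x ∈ U, r x ∈ L.constraintSpace) →
        L.SolvesEulerLagrange U (fun x => (r x).point) ∧
        L.SolvesCartan U (fun x => H.map (r x))) ∧
    (∀ sbar : X → Polysymplectic.Jet B,
      L.SolvesCartan U sbar →
      (∀ x ∈ U, H.map (L.legendre (sbar x)) = B.prolong (fun x' => (sbar x').point) x) →
        H.SolvesHamilton U (fun x => L.legendre (sbar x))) := by
  refine ⟨fun r hr hN => ?_, fun sbar hsb hint => hsb.solvesHamilton_legendre hL hH hU hint⟩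
  have hprol : ∀ x ∈ U, H.map (r x) = B.prolong (fun x' => (r x').point) x := by
    intro x hx
    obtain ⟨c, hc, -⟩ := hL.fibred (r x).point
    exact hr.map_eq_prolong c hU hx hc
  have hpt : (fun x => (H.map (r x)).point) = fun x => (r x).point :=
    funext fun x => H.map_point (r x)
  have hC := hr.solvesCartan_map hL hH hU hN hprol
  refine ⟨?_, hC⟩
  have hEL := hC.solvesEulerLagrange hU (by rw [hpt]; exact hprol)
  rwa [hpt] at hEL
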